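/- Let $n,m\ge 1$ and $p=\min(n,m)$. Let $\mathbf G_{n,m}$ be the Grassmannian of oriented $n$-dimensional subspaces of $\mathbb R^{n+m}$, let $\varepsilon_1,\dots,\varepsilon_{n+m}$ be an orthonormal basis of $\mathbb R^{n+m}$, and let $P_0\in\mathbf G_{n,m}$ be spanned by $\varepsilon_1\wedge\cdots\wedge\varepsilon_n$. For $P\in\mathbf G_{n,m}$ spanned by $e_1\wedge\cdots\wedge e_n$ with $(e_i)$ orthonormal, put $W=(\langle e_i,\varepsilon_j\rangle)_{1\le i,j\le n}$ and $w(P)=\det W$; the Jordan angles between $P$ and $P_0$ are $\theta_i=\arccos\mu_i\in[0,\frac{\pi}{2}]$, $1\le i\le n$, where $\mu_1^2,\dots,\mu_n^2$ ($\mu_i\ge 0$) are the eigenvalues of $W^TW$ with multiplicity (at most $p$ of the $\theta_i$ are nonzero). Let $$\mathbb U=\{P\in\mathbf G_{n,m}: w(P)>0\},\qquad B_{JX}(P_0)=\Big\{P\in\mathbb U:\ \theta_i+\theta_j<\frac{\pi}{2}\ \text{ for all } i\neq j\Big\}.$$ Every $P\in\mathbb U$ is spanned by $f_i=\varepsilon_i+\sum_{\alpha=1}^m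 z_{i\alpha}\varepsilon_{n+\alpha}$ $(1\le i\le n)$ for a unique real $n\times m$ matrix $Z=(z_{i\alpha})$, and $P\mapsto Z$ is a global coordinate system on $\mathbb U$. Let $$g=\operatorname{tr}\big((I_n+ZZ^T)^{-1}dZ\,(I_m+Z^TZ)^{-1}dZ^T\big)$$ be the canonical metric on $\mathbb U$ in these coordinates, let $\operatorname{Hess}$ be the Hessian with respect to its Levi-Civita connection, and define $u:\mathbb U\to\mathbb R$ by $u=\sum_{i}\tan^2\theta_i$. Then $u=\operatorname{tr}(ZZ^T)$ on $\mathbb U$. The function $u$ is convex on $B_{JX}(P_0)$: its Hessian is positive definite at every point of $B_{JX}(P_0)$, and $u\circ\gamma$ is convex for every geodesic $\gamma:I\to B_{JX}(P_0)$ on an open interval $I$. Moreover, on $\{P\in\mathbb U: u(P)\le 2\}$, $$\operatorname{Hess}(u)\ \ge\ \Big(2-\frac{1}{2}u^2\Big)g+\frac{\big(3+\frac{1}{4}p^2\big)u+4p}{2(u+p)^2}\,du\otimes du$$ as quadratic forms on each tangent space. -/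

import Mathlib

open scoped Matrix

noncomputable section

namespace OGrass

/-! ### Oriented `n`-planes in `ℝ^(n+m)` -/

/-- The Euclidean space `ℝ^(n+m)`. -/
abbrev Ambient (n m : ℕ) : Type := EuclideanSpace ℝ (Fin (n + m))

/-- Orthonormal `n`-frames `(e_1, …, e_n)` in `ℝ^(n+m)`. -/
abbrev Frame (n m : ℕ) : Type := {e : Fin n → Ambient n m // Orthonormal ℝ e}

/-- An orthonormal basis `ε_1, …, ε_n, ε_{n+1}, …, ε_{n+m}` of `ℝ^(n+m)`: the vectors
`ε (Sum.inl i)` are `ε_i` and span the reference plane `P₀`, the vectors `ε (Sum.inr α)` are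
`ε_{n+α}`. -/
abbrev RefBasis (n m : ℕ) : Type := OrthonormalBasis (Fin n ⊕ Fin m) ℝ (Ambient n m)

variable {n m : ℕ}

/-- Two orthonormal frames span the same oriented plane iff they differ by an element of `SO(n)`. -/
def SameOrientedPlane (e e' : Frame n m) : Prop :=
  ∃ A ∈ Matrix.specialOrthogonalGroup (Fin n) ℝ, ∀ i, e'.1 i = ∑ j, A i j • e.1 j

theorem sameOrientedPlane_equivalence :
    Equivalence (SameOrientedPlane : Frame n m → Frame n m → Prop) where
  refl e := ⟨1, one_mem _, fun i => by simp [Matrix.one_apply, ite_smul]⟩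
  symm := by
    rintro e e' ⟨A, hA, h⟩
    have hA' := (Matrix.mem_specialOrthogonalGroup_iff.1 hA)
    have h1 : Aᵀ * A = 1 := (Matrix.mem_orthogonalGroup_iff' _ _).1 hA'.1
    have h2 : A * Aᵀ = 1 := (Matrix.mem_orthogonalGroup_iff _ _).1 hA'.1
    refine ⟨Aᵀ, Matrix.mem_specialOrthogonalGroup_iff.2
      ⟨(Matrix.mem_orthogonalGroup_iff _ _).2 (by simpa using h1), by simpa using hA'.2⟩, fun i => ?_⟩
    simp only [h, Finset.smul_sum, smul_smul]
    rw [Finset.sum_comm]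
    simp only [← Finset.sum_smul, ← Matrix.mul_apply, h1]
    simp [Matrix.one_apply, ite_smul]
  trans := by
    rintro e e' e'' ⟨A, hA, h⟩ ⟨B, hB, h'⟩
    refine ⟨B * A, mul_mem hB hA, fun i => ?_⟩
    simp only [h', h, Finset.smul_sum, smul_smul]
    rw [Finset.sum_comm]
    simp only [← Finset.sum_smul, ← Matrix.mul_apply]

instance frameSetoid (n m : ℕ) : Setoid (Frame n m) where
  r := SameOrientedPlane
  iseqv := sameOrientedPlane_equivalence

/-- The Grassmannian `G_{n,m}` of oriented `n`-planes in `ℝ^(n+m)`. -/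
def Grassmannian (n m : ℕ) : Type := Quotient (frameSetoid n m)

/-- The `n × n` matrix `W = (⟨e_i, ε_j⟩)`. -/
def matW (ε : RefBasis n m) (e : Frame n m) : Matrix (Fin n) (Fin n) ℝ :=
  Matrix.of fun i j => inner ℝ (e.1 i) (ε (Sum.inl j))

/-- The `n × m` matrix `V = (⟨e_i, ε_{n+α}⟩)`. -/
def matV (ε : RefBasis n m) (e : Frame n m) : Matrix (Fin n) (Fin m) ℝ :=
  Matrix.of fun i α => inner ℝ (e.1 i) (ε (Sum.inr α))

theorem matW_of_rel (ε : RefBasis n m) {e e' : Frame n m} {A : Matrix (Fin n) (Fin n) ℝ}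
    (h : ∀ i, e'.1 i = ∑ j, A i j • e.1 j) : matW ε e' = A * matW ε e := by
  ext i j
  simp [matW, Matrix.mul_apply, h, sum_inner, real_inner_smul_left]

theorem matV_of_rel (ε : RefBasis n m) {e e' : Frame n m} {A : Matrix (Fin n) (Fin n) ℝ}
    (h : ∀ i, e'.1 i = ∑ j, A i j • e.1 j) : matV ε e' = A * matV ε e := by
  ext i j
  simp [matV, Matrix.mul_apply, h, sum_inner, real_inner_smul_left]

/-- `w(P) = ⟨P, P₀⟩ = det W`. -/
def w (ε : RefBasis n m) : Grassmannian n m → ℝ :=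
  Quotient.lift (fun e => (matW ε e).det) (by
    rintro e e' ⟨A, hA, h⟩
    simp only [matW_of_rel ε h, Matrix.det_mul, (Matrix.mem_specialOrthogonalGroup_iff.1 hA).2,
      one_mul])

/-- The matrix `Wᵀ W`, which depends on the plane only. -/
def cosSq (ε : RefBasis n m) : Grassmannian n m → Matrix (Fin n) (Fin n) ℝ :=
  Quotient.lift (fun e => (matW ε e)ᵀ * matW ε e) (by
    rintro e e' ⟨A, hA, h⟩
    have h1 : Aᵀ * A = 1 :=
      (Matrix.mem_orthogonalGroup_iff' _ _).1 (Matrix.mem_specialOrthogonalGroup_iff.1 hA).1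
    simp only [matW_of_rel ε h, Matrix.transpose_mul]
    rw [Matrix.mul_assoc, ← Matrix.mul_assoc Aᵀ, h1, Matrix.one_mul])

theorem cosSq_isHermitian (ε : RefBasis n m) (P : Grassmannian n m) : (cosSq ε P).IsHermitian := by
  induction P using Quotient.inductionOn with
  | h e => exact Matrix.isHermitian_conjTranspose_mul_self (matW ε e)

/-- The Jordan angles `θ_i = arccos μ_i` between `P` and `P₀`, where `μ_1², …, μ_n²` are the
eigenvalues of `Wᵀ W` with multiplicity. (At most `p = min n m` of the `n` angles are nonzero.) -/
def jordanAngle (ε : RefBasis n m) (P : Grassmannian n m) (i : Fin n) : ℝ :=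
  Real.arccos (Real.sqrt ((cosSq_isHermitian ε P).eigenvalues i))

/-- The open set `𝕌 = {P : w(P) > 0}`. -/
abbrev U (ε : RefBasis n m) : Type := {P : Grassmannian n m // 0 < w ε P}

/-- `B_JX(P₀)`: the planes in `𝕌` such that any two of their Jordan angles with `P₀` have sum
less than `π / 2`. -/
def BJX (ε : RefBasis n m) : Set (U ε) :=
  {P | ∀ i j : Fin n, i ≠ j → jordanAngle ε P.1 i + jordanAngle ε P.1 j < Real.pi / 2}

/-- `u = ∑ tan² θ_i` on `𝕌`. -/
def u (ε : RefBasis n m) (P : U ε) : ℝ := ∑ i, Real.tan (jordanAngle ε P.1 i) ^ 2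

/-! ### The coordinates `Z` on `𝕌` -/

/-- The matrix `Z = W⁻¹ V`; for `P ∈ 𝕌` it is the matrix such that `P` is spanned by the vectors
`f_i = ε_i + ∑ α, z_{iα} ε_{n+α}` (see `frame_eq`). -/
def coord (ε : RefBasis n m) : Grassmannian n m → Matrix (Fin n) (Fin m) ℝ :=
  Quotient.lift (fun e => (matW ε e)⁻¹ * matV ε e) (by
    rintro e e' ⟨A, hA, h⟩
    have h1 : Aᵀ * A = 1 :=
      (Matrix.mem_orthogonalGroup_iff' _ _).1 (Matrix.mem_specialOrthogonalGroup_iff.1 hA).1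
    simp only [matW_of_rel ε h, matV_of_rel ε h, Matrix.mul_inv_rev, Matrix.inv_eq_left_inv h1]
    rw [Matrix.mul_assoc, ← Matrix.mul_assoc Aᵀ, h1, Matrix.one_mul])

/-- The vectors `f_i = ε_i + ∑ α, z_{iα} ε_{n+α}`. -/
def graphVec (ε : RefBasis n m) (Z : Matrix (Fin n) (Fin m) ℝ) (i : Fin n) : Ambient n m :=
  ε (Sum.inl i) + ∑ α, Z i α • ε (Sum.inr α)

theorem inner_graphVec (ε : RefBasis n m) (Z : Matrix (Fin n) (Fin m) ℝ) (i j : Fin n) :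
    inner ℝ (graphVec ε Z i) (graphVec ε Z j) = (1 + Z * Zᵀ : Matrix (Fin n) (Fin n) ℝ) i j := by
  simp [graphVec, inner_add_left, inner_add_right, sum_inner, inner_sum, real_inner_smul_left,
    real_inner_smul_right, ε.inner_eq_ite, Matrix.mul_apply, Matrix.one_apply, eq_comm, mul_comm]

theorem inner_sum_graphVec (ε : RefBasis n m) (Z : Matrix (Fin n) (Fin m) ℝ)
    (A : Matrix (Fin n) (Fin n) ℝ) (i j : Fin n) :
    inner ℝ (∑ k, A i k • graphVec ε Z k) (∑ l, A j l • graphVec ε Z l)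
      = (A * (1 + Z * Zᵀ) * Aᵀ : Matrix (Fin n) (Fin n) ℝ) i j := by
  rw [Matrix.mul_apply]
  simp only [Matrix.mul_apply (M := A), Matrix.transpose_apply, Finset.sum_mul, sum_inner,
    inner_sum, real_inner_smul_left, real_inner_smul_right, inner_graphVec]
  refine Finset.sum_congr rfl fun k _ => Finset.sum_congr rfl fun l _ => by ring

theorem frame_eq (ε : RefBasis n m) (e : Frame n m) (h : 0 < (matW ε e).det) (i : Fin n) :
    e.1 i = ∑ j, matW ε e i j • graphVec ε ((matW ε e)⁻¹ * matV ε e) j := by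
  have hu : IsUnit (matW ε e).det := h.ne'.isUnit
  have hV : matV ε e = matW ε e * ((matW ε e)⁻¹ * matV ε e) := by
    rw [← Matrix.mul_assoc, Matrix.mul_nonsing_inv _ hu, Matrix.one_mul]
  have hV' : ∀ α, matV ε e i α = ∑ j, matW ε e i j * ((matW ε e)⁻¹ * matV ε e) j α := fun α => by
    conv_lhs => rw [hV]
    rw [Matrix.mul_apply]
  have hs := ε.sum_repr' (e.1 i)
  rw [Fintype.sum_sum_type] at hs
  simp only [graphVec, smul_add, Finset.sum_add_distrib, Finset.smul_sum, smul_smul]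
  rw [Finset.sum_comm (s := Finset.univ (α := Fin n)) (t := Finset.univ (α := Fin m))]
  simp only [← Finset.sum_smul, ← hV']
  conv_lhs => rw [← hs]
  simp [matW, matV, real_inner_comm]

theorem matW_gram (ε : RefBasis n m) (e : Frame n m) (h : 0 < (matW ε e).det) :
    matW ε e * (1 + ((matW ε e)⁻¹ * matV ε e) * ((matW ε e)⁻¹ * matV ε e)ᵀ) * (matW ε e)ᵀ = 1 := by
  ext i j
  have ho := orthonormal_iff_ite.1 e.2 i j
  rw [frame_eq ε e h i, frame_eq ε e h j, inner_sum_graphVec] at ho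
  rw [Matrix.one_apply, ← ho]

theorem coord_injective (ε : RefBasis n m) : Function.Injective fun P : U ε => coord ε P.1 := by
  rintro ⟨P, hP⟩ ⟨P', hP'⟩ h
  induction P using Quotient.inductionOn with
  | h e =>
  induction P' using Quotient.inductionOn with
  | h e' =>
  change 0 < (matW ε e).det at hP
  change 0 < (matW ε e').det at hP'
  change (matW ε e)⁻¹ * matV ε e = (matW ε e')⁻¹ * matV ε e' at h
  have hu : IsUnit (matW ε e).det := hP.ne'.isUnit
  have g := matW_gram ε e hP
  have g' := matW_gram ε e' hP'
  have f := frame_eq ε e hP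
  have f' := frame_eq ε e' hP'
  rw [← h] at g' f'
  generalize (matW ε e)⁻¹ * matV ε e = Z at g g' f f'
  obtain ⟨W, hW⟩ : ∃ W, W = matW ε e := ⟨_, rfl⟩
  obtain ⟨W', hW'⟩ : ∃ W', W' = matW ε e' := ⟨_, rfl⟩
  rw [← hW] at g hu
  rw [← hW'] at g'
  simp only [← hW] at f
  simp only [← hW'] at f'
  have hd : 0 < (W' * W⁻¹).det := by
    rw [Matrix.det_mul, Matrix.det_nonsing_inv, Ring.inverse_eq_inv']
    rw [← hW] at hP
    rw [← hW'] at hP'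
    positivity
  have hK : (1 + Z * Zᵀ) = W⁻¹ * W⁻¹ᵀ := by
    have hu' : IsUnit Wᵀ.det := by rwa [Matrix.det_transpose]
    calc (1 + Z * Zᵀ) = W⁻¹ * (W * (1 + Z * Zᵀ) * Wᵀ) * Wᵀ⁻¹ := by
          rw [Matrix.mul_assoc W, Matrix.nonsing_inv_mul_cancel_left _ _ hu,
            Matrix.mul_nonsing_inv_cancel_right _ _ hu']
      _ = _ := by rw [g, Matrix.mul_one, Matrix.transpose_nonsing_inv]
  have hO : (W' * W⁻¹) * (W' * W⁻¹)ᵀ = 1 := by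
    rw [Matrix.transpose_mul, ← g', hK]
    simp only [Matrix.mul_assoc]
  have hdet : (W' * W⁻¹).det = 1 := by
    have := congrArg Matrix.det hO
    rw [Matrix.det_mul, Matrix.det_transpose, Matrix.det_one] at this
    nlinarith
  refine Subtype.ext (Quotient.sound ⟨W' * W⁻¹, Matrix.mem_specialOrthogonalGroup_iff.2
    ⟨(Matrix.mem_orthogonalGroup_iff _ _).2 hO, hdet⟩, fun i => ?_⟩)
  simp only [f, Finset.smul_sum, smul_smul]
  rw [Finset.sum_comm]
  simp only [← Finset.sum_smul, ← Matrix.mul_apply, Matrix.nonsing_inv_mul_cancel_right _ _ hu]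
  exact f' i

open scoped MatrixOrder in
theorem coord_surjective (ε : RefBasis n m) : Function.Surjective fun P : U ε => coord ε P.1 := by
  intro Z
  have hK : (1 + Z * Zᵀ).PosDef :=
    Matrix.PosDef.one.add_posSemidef (Matrix.posSemidef_self_mul_conjTranspose Z)
  obtain ⟨S, hS, hd⟩ : ∃ S : Matrix (Fin n) (Fin n) ℝ, S * (1 + Z * Zᵀ) * Sᵀ = 1 ∧ 0 < S.det := by
    have hR0 : (CFC.sqrt (1 + Z * Zᵀ)).PosSemidef :=
      Matrix.nonneg_iff_posSemidef.1 (CFC.sqrt_nonneg _)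
    have hRR : CFC.sqrt (1 + Z * Zᵀ) * CFC.sqrt (1 + Z * Zᵀ) = 1 + Z * Zᵀ :=
      CFC.sqrt_mul_sqrt_self _ hK.posSemidef.nonneg
    generalize CFC.sqrt (1 + Z * Zᵀ) = R at hR0 hRR
    have hRd : 0 < R.det := by
      have h1 := congrArg Matrix.det hRR
      rw [Matrix.det_mul] at h1
      have h2 := hK.det_pos
      have h3 := hR0.det_nonneg
      rw [← h1] at h2
      exact lt_of_le_of_ne h3 fun h => by rw [← h] at h2; simp at h2
    have hu : IsUnit R.det := hRd.ne'.isUnit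
    have hT : Rᵀ = R := hR0.isHermitian
    refine ⟨R⁻¹, ?_, ?_⟩
    · rw [Matrix.transpose_nonsing_inv, hT, ← hRR, Matrix.nonsing_inv_mul_cancel_left _ _ hu,
        Matrix.mul_nonsing_inv _ hu]
    · rw [Matrix.det_nonsing_inv, Ring.inverse_eq_inv']
      positivity
  have hu : IsUnit S.det := hd.ne'.isUnit
  let e : Frame n m := ⟨fun i => ∑ j, S i j • graphVec ε Z j, by
    rw [orthonormal_iff_ite]
    intro i j
    rw [inner_sum_graphVec, hS, Matrix.one_apply]⟩
  have hW : matW ε e = S := by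
    ext i j
    simp [matW, e, graphVec, sum_inner, inner_add_left, real_inner_smul_left, ε.inner_eq_ite]
  have hV : matV ε e = S * Z := by
    ext i j
    simp [matV, e, graphVec, sum_inner, inner_add_left, real_inner_smul_left, ε.inner_eq_ite,
      Matrix.mul_apply]
  refine ⟨⟨Quotient.mk _ e, ?_⟩, ?_⟩
  · change 0 < (matW ε e).det
    rwa [hW]
  · change (matW ε e)⁻¹ * matV ε e = Z
    rw [hW, hV, Matrix.nonsing_inv_mul_cancel_left _ _ hu]

/-- The global coordinate system `P ↦ Z` on `𝕌`. -/
def chart (ε : RefBasis n m) : U ε ≃ Matrix (Fin n) (Fin m) ℝ :=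
  Equiv.ofBijective (fun P => coord ε P.1) ⟨coord_injective ε, coord_surjective ε⟩

/-! ### The canonical metric, its Christoffel symbols and the Hessian, in the coordinates `Z`

A tangent vector at a point of `𝕌` is given by its components, an `n × m` matrix. -/

/-- The canonical metric `g = tr((I_n + Z Zᵀ)⁻¹ dZ (I_m + Zᵀ Z)⁻¹ dZᵀ)` at `Z`. -/
def metric (Z X Y : Matrix (Fin n) (Fin m) ℝ) : ℝ :=
  ((1 + Z * Zᵀ)⁻¹ * X * (1 + Zᵀ * Z)⁻¹ * Yᵀ).trace

/-- The coordinate vector `E_{iα}`. -/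
def E (a : Fin n × Fin m) : Matrix (Fin n) (Fin m) ℝ := Matrix.single a.1 a.2 1

/-- The partial derivative with respect to the coordinate `z_{iα}`. -/
def pd (a : Fin n × Fin m) (F : Matrix (Fin n) (Fin m) ℝ → ℝ) (Z : Matrix (Fin n) (Fin m) ℝ) : ℝ :=
  lineDeriv ℝ F Z (E a)

/-- The matrix `(g_{iα,jβ})` of the metric. -/
def metricMatrix (Z : Matrix (Fin n) (Fin m) ℝ) : Matrix (Fin n × Fin m) (Fin n × Fin m) ℝ :=
  Matrix.of fun a b => metric Z (E a) (E b)

/-- The Christoffel symbols `Γ^c_{ab}` of the Levi-Civita connection,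
`Γ^c_{ab} = ½ ∑ d, g^{cd} (-∂_d g_{ab} + ∂_a g_{bd} + ∂_b g_{da})`. -/
def christoffel (Z : Matrix (Fin n) (Fin m) ℝ) (c a b : Fin n × Fin m) : ℝ :=
  (1 / 2) * ∑ d, (metricMatrix Z)⁻¹ c d *
    (-pd d (fun Y => metricMatrix Y a b) Z + pd a (fun Y => metricMatrix Y b d) Z
      + pd b (fun Y => metricMatrix Y d a) Z)

/-- The differential `dF(X)` of a function `F` on `𝕌` at `P`. -/
def differential (ε : RefBasis n m) (F : U ε → ℝ) (P : U ε) (X : Matrix (Fin n) (Fin m) ℝ) : ℝ :=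
  ∑ a : Fin n × Fin m, X a.1 a.2 * pd a (F ∘ (chart ε).symm) (chart ε P)

/-- The Hessian `Hess(F)(X, Y) = ∑ X_a Y_b (∂_a ∂_b F - ∑ Γ^c_{ab} ∂_c F)` of a function `F` on `𝕌`
at `P`. -/
def hessian (ε : RefBasis n m) (F : U ε → ℝ) (P : U ε) (X Y : Matrix (Fin n) (Fin m) ℝ) : ℝ :=
  ∑ a : Fin n × Fin m, ∑ b : Fin n × Fin m, X a.1 a.2 * Y b.1 b.2 *
    (pd a (pd b (F ∘ (chart ε).symm)) (chart ε P)
      - ∑ c, christoffel (chart ε P) c a b * pd c (F ∘ (chart ε).symm) (chart ε P))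

/-- `γ` is a geodesic of `𝕌` on the open interval `I`: its coordinates `z_c(t)` are twice
differentiable and satisfy `z_c'' + ∑ Γ^c_{ab} z_a' z_b' = 0`. -/
def IsGeodesicOn (ε : RefBasis n m) (γ : ℝ → U ε) (I : Set ℝ) : Prop :=
  ∃ ξ : ℝ → Matrix (Fin n) (Fin m) ℝ, ∀ t ∈ I, ∀ c : Fin n × Fin m,
    HasDerivAt (fun s => chart ε (γ s) c.1 c.2) (ξ t c.1 c.2) t ∧
    HasDerivAt (fun s => ξ s c.1 c.2)
      (-∑ a : Fin n × Fin m, ∑ b : Fin n × Fin m,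
        christoffel (chart ε (γ t)) c a b * ξ t a.1 a.2 * ξ t b.1 b.2) t

/-- `F` is convex along every geodesic contained in `S`. -/
def GeodesicallyConvexOn (ε : RefBasis n m) (S : Set (U ε)) (F : U ε → ℝ) : Prop :=
  ∀ (γ : ℝ → U ε) (I : Set ℝ), IsOpen I → Convex ℝ I → IsGeodesicOn ε γ I →
    (∀ t ∈ I, γ t ∈ S) → ConvexOn ℝ I (fun t => F (γ t))

end OGrass

end

open scoped Matrix

noncomputable section

namespace OGrass

variable {n m : ℕ}

/-! ### Scalar inequalities -/

/-! In the coordinates `Z` the function is u = tr(Z Zᵀ), since Wᵀ W = (1 + Z Zᵀ)⁻¹: the eigenvalues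
of Z Zᵀ are tan² θ_i. The Koszul formula contracts the Christoffel symbols to Γ(X, X) = -2 X Zᵀ (1 +
Z Zᵀ)⁻¹ X (`metricDeriv_koszul`, `sum_christoffel`), whence Hess u(X, X) = 2 tr(X Xᵀ) + 4 tr(X Zᵀ (1
+ Z Zᵀ)⁻¹ X Zᵀ) (`hessian_u`).

Rotate by an orthogonal V diagonalizing Z Zᵀ, put N = Vᵀ Z, Y = Vᵀ X, l_i = tan θ_i, and let c_ij be
the component of row i of Y along the normalized row j of N. Then Hess u = 2 ∑ r_i + ∑_ij (2 c_ij² +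
4 l_i l_j c_ij c_ji / (1 + l_j²)), with residuals r_i ≥ 0 by Bessel. Only c_ij and c_ji interact, so
the form splits into binary forms. Each off-diagonal one is positive definite when l_i l_j < 1,
which θ_i + θ_j < π/2 guarantees (`pair_pos`, `frameHessian_pos`). Convexity follows, as (u ∘ γ)'' =
Hess u(γ', γ') along a geodesic.

For the lower bound, the metric is diagonal in the r_i and c_ij. Subtracting (2 - u²/2) g leaves the
residuals and the off-diagonal pairs nonnegative (`pair_estimate`). Since du = 2 ∑ l_i c_ii, the du
⊗ du term is paid for by the diagonal part alone: Cauchy–Schwarz reduces it to bounding ∑ f(l_i²)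
for an explicit rational f, and a tangent-line argument puts the extremal case at p equal values
u/p, which produces the stated coefficient (`sum_rational_le`, `diagonal_estimate`). -/

/-- The tangent at `a` to `t ↦ t (1 + t)² / (6 t² + 8 t + k)` lies above the graph on `[0, v]`
when `v ^ 2 = 2 k ≤ 4`. -/
theorem rational_le_tangent {t a v k : ℝ} (ht : 0 ≤ t) (htv : t ≤ v) (ha : 0 < a) (hav : a ≤ v)
    (hk : 2 * k = v ^ 2) (hv : v ≤ 2) :
    t * (1 + t) ^ 2 / (6 * t ^ 2 + 8 * t + k) ≤
      a * (1 + a) ^ 2 / (6 * a ^ 2 + 8 * a + k) +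
        ((1 + a) * (1 + 3 * a) * (6 * a ^ 2 + 8 * a + k) - a * (1 + a) ^ 2 * (12 * a + 8)) /
          (6 * a ^ 2 + 8 * a + k) ^ 2 * (t - a) := by
  have hk0 : 0 < k := by nlinarith
  have hk2 : k ≤ 2 := by nlinarith
  have hQ : 0 < 6 * t ^ 2 + 8 * t + k := by positivity
  have hQa : 0 < 6 * a ^ 2 + 8 * a + k := by positivity
  have hR : 0 ≤ 12 * a * k - 2 * a * k ^ 2 - 4 * a ^ 2 * t + 6 * k * a ^ 2 * t + 4 * k * a ^ 2
      + 8 * k * a * t + 8 * k - 2 * k ^ 2 + 6 * k * t - k ^ 2 * t := by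
    -- The only negative term not absorbed by k ≤ 2 is -4a²t; a t ≤ v² = 2k bounds it by part of
    -- 12ak.
    have h1 : a * (a * t) ≤ a * (2 * k) := by
      have hv0 : 0 ≤ v := ht.trans htv
      rw [hk, pow_two]
      gcongr
    have h2 : 0 ≤ a * k * (2 - k) := mul_nonneg (by positivity) (by linarith)
    have h3 : 0 ≤ k * (2 - k) := mul_nonneg (by positivity) (by linarith)
    have h4 : 0 ≤ k * t * (2 - k) := mul_nonneg (by positivity) (by linarith)
    have h5 : 0 ≤ k * a ^ 2 * t := by positivity
    have h6 : 0 ≤ k * a ^ 2 := by positivity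
    have h7 : 0 ≤ k * a * t := by positivity
    have h8 : 0 ≤ k * t := by positivity
    nlinarith
  rw [← sub_nonneg]
  -- Tangency at a makes (t - a)² divide the difference, and the cofactor is the polynomial of `hR`.
  have key : a * (1 + a) ^ 2 / (6 * a ^ 2 + 8 * a + k) +
        ((1 + a) * (1 + 3 * a) * (6 * a ^ 2 + 8 * a + k) - a * (1 + a) ^ 2 * (12 * a + 8)) /
          (6 * a ^ 2 + 8 * a + k) ^ 2 * (t - a) - t * (1 + t) ^ 2 / (6 * t ^ 2 + 8 * t + k) =
      (t - a) ^ 2 * (12 * a * k - 2 * a * k ^ 2 - 4 * a ^ 2 * t + 6 * k * a ^ 2 * t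
        + 4 * k * a ^ 2 + 8 * k * a * t + 8 * k - 2 * k ^ 2 + 6 * k * t - k ^ 2 * t) /
        ((6 * a ^ 2 + 8 * a + k) ^ 2 * (6 * t ^ 2 + 8 * t + k)) := by
    rw [eq_div_iff (by positivity)]
    field_simp
    ring
  rw [key]
  positivity

/-- The summand f need not be concave, but on [0, v] it lies below its tangent at v / p. Summing the
tangent bound over the nonzero t i cancels the slope, because the t i add up to v. -/
theorem sum_rational_le {ι : Type*} [Fintype ι] (t : ι → ℝ) (ht : ∀ i, 0 ≤ t i) {v p : ℝ}
    (hsum : ∑ i, t i = v) (hv0 : 0 < v) (hv : v ≤ 2)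
    (hp : ((Finset.univ.filter fun i => t i ≠ 0).card : ℝ) ≤ p) (hp1 : 1 ≤ p) :
    ∑ i, t i * (1 + t i) ^ 2 / (6 * t i ^ 2 + 8 * t i + v ^ 2 / 2) ≤
      p * ((v / p) * (1 + v / p) ^ 2 / (6 * (v / p) ^ 2 + 8 * (v / p) + v ^ 2 / 2)) := by
  classical
  have hp0 : 0 < p := by linarith
  have ha : 0 < v / p := by positivity
  have hav : v / p ≤ v := div_le_self hv0.le hp1
  have hk : 2 * (v ^ 2 / 2) = v ^ 2 := by ring
  have htv : ∀ i, t i ≤ v := fun i => hsum ▸ Finset.single_le_sum (fun j _ => ht j) (Finset.mem_univ i)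
  have hpa : p * (v / p) = v := by field_simp
  obtain ⟨s, hs⟩ : ∃ s, ∀ x : ℝ, 0 ≤ x → x ≤ v →
      x * (1 + x) ^ 2 / (6 * x ^ 2 + 8 * x + v ^ 2 / 2) ≤
      (v / p) * (1 + v / p) ^ 2 / (6 * (v / p) ^ 2 + 8 * (v / p) + v ^ 2 / 2) + s * (x - v / p) :=
    ⟨_, fun x hx hxv => rational_le_tangent hx hxv ha hav hk hv⟩
  generalize v / p = a at *
  generalize a * (1 + a) ^ 2 / (6 * a ^ 2 + 8 * a + v ^ 2 / 2) = b at *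
  -- At 0 the tangent line lies above f(0) = 0, so b - s a ≥ 0; this allows the number of nonzero
  -- terms to be replaced by the larger p.
  have h0 := hs 0 le_rfl hv0.le
  rw [zero_mul, zero_div] at h0
  set S := Finset.univ.filter fun i => t i ≠ 0 with hS
  have hS' : ∀ i, i ∉ S → t i = 0 := fun i hi => by simpa [hS] using hi
  calc _ = ∑ i ∈ S, t i * (1 + t i) ^ 2 / (6 * t i ^ 2 + 8 * t i + v ^ 2 / 2) :=
        (Finset.sum_subset (Finset.subset_univ _) fun i _ hi => by simp [hS' i hi]).symm
    _ ≤ ∑ i ∈ S, (b + s * (t i - a)) := Finset.sum_le_sum fun i _ => hs _ (ht i) (htv i)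
    _ = S.card * (b + s * (0 - a)) + s * ∑ i ∈ S, t i := by
        rw [Finset.mul_sum, ← nsmul_eq_mul, ← Finset.sum_const, ← Finset.sum_add_distrib]
        exact Finset.sum_congr rfl fun i _ => by ring
    _ = S.card * (b + s * (0 - a)) + s * v := by
        rw [← hsum, Finset.sum_subset (Finset.subset_univ S) fun i _ hi => hS' i hi]
    _ ≤ p * (b + s * (0 - a)) + s * v := by gcongr
    _ = p * b := by rw [← hpa]; ring

/-- Weighted Cauchy–Schwarz, with the weights of the right-hand side; the sum of l i ^ 2 over
weights is then bounded by its value at p equal entries. -/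
theorem diagonal_estimate {ι : Type*} [Fintype ι] (l x : ι → ℝ) {v p : ℝ}
    (hsum : ∑ i, l i ^ 2 = v) (hv : v ≤ 2)
    (hp : ((Finset.univ.filter fun i => l i ≠ 0).card : ℝ) ≤ p) (hp1 : 1 ≤ p) :
    ((3 + p ^ 2 / 4) * v + 4 * p) / (2 * (v + p) ^ 2) * (2 * ∑ i, l i * x i) ^ 2 ≤
      ∑ i, (6 * (l i ^ 2) ^ 2 + 8 * l i ^ 2 + v ^ 2 / 2) / (1 + l i ^ 2) ^ 2 * x i ^ 2 := by
  have hv0 : 0 ≤ v := hsum ▸ Finset.sum_nonneg fun i _ => sq_nonneg _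
  have hp0 : 0 < p := by linarith
  rcases hv0.eq_or_lt with rfl | hvpos
  · have hl : ∀ i, l i = 0 := fun i => by
      have := (Finset.sum_eq_zero_iff_of_nonneg fun i _ => sq_nonneg (l i)).1 hsum i
        (Finset.mem_univ i)
      exact pow_eq_zero_iff two_ne_zero |>.1 this
    simp [hl]
  have hcs : (∑ i, l i * x i) ^ 2 ≤
      (∑ i, l i ^ 2 * (1 + l i ^ 2) ^ 2 / (6 * (l i ^ 2) ^ 2 + 8 * l i ^ 2 + v ^ 2 / 2)) *
      ∑ i, (6 * (l i ^ 2) ^ 2 + 8 * l i ^ 2 + v ^ 2 / 2) / (1 + l i ^ 2) ^ 2 * x i ^ 2 := by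
    refine Finset.sum_sq_le_sum_mul_sum_of_sq_le_mul _ (fun i _ => by positivity)
      (fun i _ => by positivity) fun i _ => le_of_eq ?_
    have h1 : 6 * (l i ^ 2) ^ 2 + 8 * l i ^ 2 + v ^ 2 / 2 ≠ 0 := by positivity
    field_simp
  have hle := sum_rational_le (fun i => l i ^ 2) (fun i => sq_nonneg _) hsum hvpos hv
    (by simpa using hp) hp1
  have hD : 0 ≤ ∑ i, (6 * (l i ^ 2) ^ 2 + 8 * l i ^ 2 + v ^ 2 / 2) / (1 + l i ^ 2) ^ 2 * x i ^ 2 :=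
    Finset.sum_nonneg fun i _ => by positivity
  -- The coefficient of the square is exactly the reciprocal of the extremal Cauchy–Schwarz factor,
  -- up to the 4 coming from du = 2 ∑ l i x i.
  have hone : ((3 + p ^ 2 / 4) * v + 4 * p) / (2 * (v + p) ^ 2) * 4 *
      (p * ((v / p) * (1 + v / p) ^ 2 / (6 * (v / p) ^ 2 + 8 * (v / p) + v ^ 2 / 2))) = 1 := by
    have h1 : 6 * (v / p) ^ 2 + 8 * (v / p) + v ^ 2 / 2 =
        2 * v / p ^ 2 * ((3 + p ^ 2 / 4) * v + 4 * p) := by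
      field_simp
      ring
    have h2 : (3 + p ^ 2 / 4) * v + 4 * p ≠ 0 := by positivity
    have h3 : 1 + v / p = (v + p) / p := by field_simp; ring
    rw [h1, h3]
    generalize (3 + p ^ 2 / 4) * v + 4 * p = q at *
    have h4 : v + p ≠ 0 := by positivity
    field_simp
    norm_num
  have hK : 0 ≤ ((3 + p ^ 2 / 4) * v + 4 * p) / (2 * (v + p) ^ 2) := by positivity
  generalize ((3 + p ^ 2 / 4) * v + 4 * p) / (2 * (v + p) ^ 2) = K at *
  calc K * (2 * ∑ i, l i * x i) ^ 2 = K * 4 * (∑ i, l i * x i) ^ 2 := by ring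
    _ ≤ K * 4 * (_ * _) := mul_le_mul_of_nonneg_left (hcs.trans
        (mul_le_mul_of_nonneg_right hle hD)) (by positivity)
    _ = _ := by rw [← mul_assoc, hone, one_mul]

/-- A double sum is at least its diagonal part if the off-diagonal terms are nonnegative in pairs. -/
theorem sum_diag_le_sum_sum {ι : Type*} [Fintype ι] (F : ι → ι → ℝ)
    (h : ∀ i j, i ≠ j → 0 ≤ F i j + F j i) : ∑ i, F i i ≤ ∑ i, ∑ j, F i j := by
  classical
  have h1 : ∑ i, ∑ j, (F i j + F j i) = 2 * ∑ i, ∑ j, F i j := by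
    simp only [Finset.sum_add_distrib]
    rw [Finset.sum_comm (f := fun i j => F j i)]
    ring
  have h2 : ∑ i, 2 * F i i ≤ ∑ i, ∑ j, (F i j + F j i) := Finset.sum_le_sum fun i _ => by
    rw [← Finset.add_sum_erase _ _ (Finset.mem_univ i)]
    have := Finset.sum_nonneg (s := Finset.univ.erase i) (f := fun j => F i j + F j i)
      fun j hj => h i j (Finset.ne_of_mem_erase hj).symm
    linarith
  rw [← Finset.mul_sum] at h2
  linarith

/-- Over the common denominator the form is a multiple of (c + d)² plus a multiple of c² + d², both
nonnegative. The second vanishes for a = b and v = a² + b², which explains the constant 2 - v²/2. -/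
theorem pair_estimate (a b c d v : ℝ) (hv : a ^ 2 + b ^ 2 ≤ v) (ha : 0 ≤ a) (hb : 0 ≤ b) :
    0 ≤ (2 * c ^ 2 + 4 * (a * b * c * d) / (1 + b ^ 2)
          - (2 - v ^ 2 / 2) * (c ^ 2 / ((1 + a ^ 2) * (1 + b ^ 2))))
      + (2 * d ^ 2 + 4 * (b * a * d * c) / (1 + a ^ 2)
          - (2 - v ^ 2 / 2) * (d ^ 2 / ((1 + b ^ 2) * (1 + a ^ 2)))) := by
  have key : (2 * c ^ 2 + 4 * (a * b * c * d) / (1 + b ^ 2)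
          - (2 - v ^ 2 / 2) * (c ^ 2 / ((1 + a ^ 2) * (1 + b ^ 2))))
      + (2 * d ^ 2 + 4 * (b * a * d * c) / (1 + a ^ 2)
          - (2 - v ^ 2 / 2) * (d ^ 2 / ((1 + b ^ 2) * (1 + a ^ 2)))) =
      (2 * (a * b) * (2 + a ^ 2 + b ^ 2) * (c + d) ^ 2
        + ((a * b - (a ^ 2 + b ^ 2) / 2) ^ 2 * 2 + 2 * (a - b) ^ 2
          + (v ^ 2 - (a ^ 2 + b ^ 2) ^ 2) / 2) * (c ^ 2 + d ^ 2)) /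
        ((1 + a ^ 2) * (1 + b ^ 2)) := by
    field_simp
    ring
  have h1 : (a ^ 2 + b ^ 2) ^ 2 ≤ v ^ 2 := by gcongr
  have h2 : 0 ≤ (v ^ 2 - (a ^ 2 + b ^ 2) ^ 2) / 2 := by linarith
  rw [key]
  positivity

/-- The factor 1 - a b multiplies c² + d²; the remaining term is a nonnegative multiple of (c + d)².
-/
theorem pair_pos (a b c d : ℝ) (hab : a * b < 1) (ha : 0 ≤ a) (hb : 0 ≤ b) (hc : c ≠ 0) :
    0 < (2 * c ^ 2 + 4 * (a * b * c * d) / (1 + b ^ 2))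
      + (2 * d ^ 2 + 4 * (b * a * d * c) / (1 + a ^ 2)) := by
  have key : (2 * c ^ 2 + 4 * (a * b * c * d) / (1 + b ^ 2))
      + (2 * d ^ 2 + 4 * (b * a * d * c) / (1 + a ^ 2)) =
      (2 * (a * b) * (2 + a ^ 2 + b ^ 2) * (c + d) ^ 2
        + 2 * (1 - a * b) * (1 - a * b + (a ^ 2 + b ^ 2)) * (c ^ 2 + d ^ 2)) /
        ((1 + a ^ 2) * (1 + b ^ 2)) := by
    field_simp
    ring
  have h1 : 0 < 1 - a * b := by linarith
  rw [key]
  positivity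

/-! ### The Hessian form in a frame in which `Z Zᵀ` is diagonal -/

section DiagonalFrame

variable {N : Matrix (Fin n) (Fin m) ℝ} {l : Fin n → ℝ}

theorem sum_mul_of_diagonal (hN : N * Nᵀ = Matrix.diagonal fun i => l i ^ 2) (i j : Fin n) :
    ∑ α, N i α * N j α = if i = j then l i ^ 2 else 0 := by
  have := congrFun (congrFun hN i) j
  simpa [Matrix.mul_apply, Matrix.diagonal_apply] using this

theorem row_eq_zero (hN : N * Nᵀ = Matrix.diagonal fun i => l i ^ 2) {i : Fin n} (hi : l i = 0)
    (α : Fin m) : N i α = 0 := by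
  have h := sum_mul_of_diagonal hN i i
  simp only [if_true, hi, ← pow_two] at h
  have h0 := (Finset.sum_eq_zero_iff_of_nonneg fun α _ => sq_nonneg (N i α)).1
    (by simpa using h) α (Finset.mem_univ α)
  exact pow_eq_zero_iff two_ne_zero |>.1 h0

/-- The components of the rows of `Y` along the normalized rows of `N`. -/
def rowComponent (N Y : Matrix (Fin n) (Fin m) ℝ) (l : Fin n → ℝ) (i j : Fin n) : ℝ :=
  (Y * Nᵀ) i j / l j

theorem mul_rowComponent (hN : N * Nᵀ = Matrix.diagonal fun i => l i ^ 2)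
    (Y : Matrix (Fin n) (Fin m) ℝ) (i j : Fin n) :
    l j * rowComponent N Y l i j = (Y * Nᵀ) i j := by
  by_cases h : l j = 0
  -- For l j = 0 the quotient is 0 by the convention x / 0 = 0, and row j of N vanishes, so the
  -- identity persists.
  · simp [Matrix.mul_apply, h, row_eq_zero hN h]
  · rw [rowComponent, mul_div_cancel₀ _ h]

/-- Bessel's inequality: the nonzero rows of N, divided by l j, are orthonormal. -/
theorem sum_rowComponent_sq_le (hN : N * Nᵀ = Matrix.diagonal fun i => l i ^ 2)
    (Y : Matrix (Fin n) (Fin m) ℝ) (i : Fin n) :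
    ∑ j, rowComponent N Y l i j ^ 2 ≤ ∑ α, Y i α ^ 2 := by
  set c := rowComponent N Y l i with hc
  have hM : ∀ j, ∑ α, Y i α * N j α = l j * c j := fun j => by
    rw [hc, mul_rowComponent hN, Matrix.mul_apply]
    rfl
  have hz : ∀ j, l j = 0 → c j = 0 := fun j hj => by simp [hc, rowComponent, hj]
  have hcl : ∀ j, c j / l j * l j = c j := fun j => by
    by_cases h : l j = 0
    · simp [h, hz j h]
    · exact div_mul_cancel₀ _ h
  have h1 : ∑ α, Y i α * ∑ j, c j / l j * N j α = ∑ j, c j ^ 2 := by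
    simp only [Finset.mul_sum]
    rw [Finset.sum_comm]
    refine Finset.sum_congr rfl fun j _ => ?_
    calc _ = c j / l j * ∑ α, Y i α * N j α := by
          rw [Finset.mul_sum]
          exact Finset.sum_congr rfl fun α _ => by ring
      _ = _ := by rw [hM, ← mul_assoc, hcl, pow_two]
  have h2 : ∑ α, (∑ j, c j / l j * N j α) ^ 2 = ∑ j, c j ^ 2 := by
    simp only [pow_two, Finset.sum_mul_sum]
    rw [Finset.sum_comm]
    refine Finset.sum_congr rfl fun j _ => ?_
    rw [Finset.sum_comm]
    calc _ = ∑ k, c j / l j * (c k / l k) * ∑ α, N j α * N k α := by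
          refine Finset.sum_congr rfl fun k _ => ?_
          rw [Finset.mul_sum]
          exact Finset.sum_congr rfl fun α _ => by ring
      _ = (c j / l j * l j) * (c j / l j * l j) := by
          simp only [sum_mul_of_diagonal hN, mul_ite, mul_zero, Finset.sum_ite_eq, Finset.mem_univ,
            if_true]
          ring
      _ = _ := by rw [hcl]
  -- The squared norm of row i minus its projection on the span of the rows of N.
  have h3 : 0 ≤ ∑ α, (Y i α - ∑ j, c j / l j * N j α) ^ 2 := Finset.sum_nonneg fun _ _ => sq_nonneg _
  simp only [sub_sq, Finset.sum_add_distrib, Finset.sum_sub_distrib, mul_assoc,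
    ← Finset.mul_sum, h1, h2] at h3
  linarith

/-- The form `2 tr(Y Yᵀ) + 4 tr(Y Nᵀ (1 + N Nᵀ)⁻¹ Y Nᵀ)` when `N Nᵀ` is the diagonal matrix with
entries `l i ^ 2`. -/
def frameHessian (N Y : Matrix (Fin n) (Fin m) ℝ) (l : Fin n → ℝ) : ℝ :=
  2 * ∑ i, ∑ α, Y i α ^ 2
    + 4 * ∑ i, ∑ j, (Y * Nᵀ) i j * (Y * Nᵀ) j i / (1 + l j ^ 2)

theorem frameHessian_eq (hN : N * Nᵀ = Matrix.diagonal fun i => l i ^ 2)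
    (Y : Matrix (Fin n) (Fin m) ℝ) :
    frameHessian N Y l =
      2 * ∑ i, (∑ α, Y i α ^ 2 - ∑ j, rowComponent N Y l i j ^ 2)
      + ∑ i, ∑ j, (2 * rowComponent N Y l i j ^ 2
        + 4 * (l i * l j * rowComponent N Y l i j * rowComponent N Y l j i) / (1 + l j ^ 2)) := by
  simp only [frameHessian, ← mul_rowComponent hN, Finset.sum_add_distrib, Finset.sum_sub_distrib,
    ← Finset.mul_sum, mul_div_assoc]
  have : ∑ i, ∑ j, l j * rowComponent N Y l i j * (l i * (rowComponent N Y l j i / (1 + l j ^ 2))) =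
      ∑ i, ∑ j, l i * l j * rowComponent N Y l i j *
        (rowComponent N Y l j i / (1 + l j ^ 2)) :=
    Finset.sum_congr rfl fun i _ => Finset.sum_congr rfl fun j _ => by ring
  rw [this]
  ring

theorem frameHessian_pos (hN : N * Nᵀ = Matrix.diagonal fun i => l i ^ 2) (hl : ∀ i, 0 ≤ l i)
    (hlt : ∀ i j, i ≠ j → l i * l j < 1) {Y : Matrix (Fin n) (Fin m) ℝ} (hY : Y ≠ 0) :
    0 < frameHessian N Y l := by
  rw [frameHessian_eq hN]
  have hr : ∀ i, 0 ≤ ∑ α, Y i α ^ 2 - ∑ j, rowComponent N Y l i j ^ 2 := fun i =>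
    sub_nonneg.2 (sum_rowComponent_sq_le hN Y i)
  have hr' := Finset.sum_nonneg fun i (_ : i ∈ Finset.univ) => hr i
  set c := rowComponent N Y l with hc
  have hdiag : ∀ i, 2 * c i i ^ 2 ≤
      2 * c i i ^ 2 + 4 * (l i * l i * c i i * c i i) / (1 + l i ^ 2) := fun i => by
    have : 0 ≤ 4 * (l i * l i * c i i * c i i) / (1 + l i ^ 2) := by
      rw [mul_assoc]
      have := mul_self_nonneg (c i i)
      have := mul_self_nonneg (l i)
      positivity
    linarith
  have hpair : ∀ i j, c i j ≠ 0 →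
      0 < (2 * c i j ^ 2 + 4 * (l i * l j * c i j * c j i) / (1 + l j ^ 2))
        + (2 * c j i ^ 2 + 4 * (l j * l i * c j i * c i j) / (1 + l i ^ 2)) := fun i j h => by
    rcases eq_or_ne i j with rfl | hij
    · have := hdiag i
      have : 0 < c i i ^ 2 := by positivity
      linarith
    · exact pair_pos _ _ _ _ (hlt i j hij) (hl i) (hl j) h
  have hpair' : ∀ i j,
      0 ≤ (2 * c i j ^ 2 + 4 * (l i * l j * c i j * c j i) / (1 + l j ^ 2))
        + (2 * c j i ^ 2 + 4 * (l j * l i * c j i * c i j) / (1 + l i ^ 2)) := fun i j => by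
    by_cases h : c i j = 0
    · rw [h]
      simp only [mul_zero, zero_mul, zero_div, add_zero]
      positivity
    · exact (hpair i j h).le
  -- Symmetrizing doubles the sum and groups it into pairs, diagonal ones included.
  have hsymm : ∑ i, ∑ j, ((2 * c i j ^ 2 + 4 * (l i * l j * c i j * c j i) / (1 + l j ^ 2))
        + (2 * c j i ^ 2 + 4 * (l j * l i * c j i * c i j) / (1 + l i ^ 2))) =
      2 * ∑ i, ∑ j, (2 * c i j ^ 2 + 4 * (l i * l j * c i j * c j i) / (1 + l j ^ 2)) := by
    rw [two_mul]
    nth_rewrite 3 [Finset.sum_comm]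
    simp only [← Finset.sum_add_distrib]
  -- If all components vanish, only 2 tr(Y Yᵀ) remains; otherwise a single pair is strictly
  -- positive.
  by_cases h0 : ∀ i j, c i j = 0
  · have hpos : 0 < ∑ i, ∑ α, Y i α ^ 2 := by
      obtain ⟨i, α, h⟩ : ∃ i α, Y i α ≠ 0 := by
        by_contra! h
        exact hY (Matrix.ext h)
      refine Finset.sum_pos' (fun i _ => Finset.sum_nonneg fun _ _ => sq_nonneg _)
        ⟨i, Finset.mem_univ _, Finset.sum_pos' (fun _ _ => sq_nonneg _)
          ⟨α, Finset.mem_univ _, by positivity⟩⟩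
    simpa [h0] using hpos
  · push Not at h0
    obtain ⟨i, j, h⟩ := h0
    have : 0 < ∑ i, ∑ j, ((2 * c i j ^ 2 + 4 * (l i * l j * c i j * c j i) / (1 + l j ^ 2))
        + (2 * c j i ^ 2 + 4 * (l j * l i * c j i * c i j) / (1 + l i ^ 2))) :=
      Finset.sum_pos' (fun i _ => Finset.sum_nonneg fun j _ => hpair' i j)
        ⟨i, Finset.mem_univ _, Finset.sum_pos' (fun j _ => hpair' i j)
          ⟨j, Finset.mem_univ _, hpair i j h⟩⟩
    linarith

/-- The number of nonzero rows of `N` is at most `min n m`. -/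
theorem card_ne_zero_le (hN : N * Nᵀ = Matrix.diagonal fun i => l i ^ 2) :
    (Finset.univ.filter fun i => l i ≠ 0).card ≤ min n m := by
  refine le_min ((Finset.card_le_univ _).trans (by simp)) ?_
  have h := Matrix.rank_mul_le_left N Nᵀ
  rw [hN, Matrix.rank_diagonal] at h
  have h2 := h.trans (Matrix.rank_le_width N)
  rw [Fintype.card_subtype] at h2
  simpa using h2

/-- After subtracting the metric term, the residuals and off-diagonal pairs are nonnegative, and the
diagonal entries dominate the square of the differential. -/
theorem frameHessian_ge (hn : 1 ≤ n) (hm : 1 ≤ m)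
    (hN : N * Nᵀ = Matrix.diagonal fun i => l i ^ 2) (hl : ∀ i, 0 ≤ l i)
    {v : ℝ} (hsum : ∑ i, l i ^ 2 = v) (hv : v ≤ 2) (Y : Matrix (Fin n) (Fin m) ℝ) :
    (2 - v ^ 2 / 2) * (∑ i, (∑ α, Y i α ^ 2
        - ∑ j, (Y * Nᵀ) i j ^ 2 / (1 + l j ^ 2)) / (1 + l i ^ 2))
      + ((3 + ((min n m : ℕ) : ℝ) ^ 2 / 4) * v + 4 * ((min n m : ℕ) : ℝ))
          / (2 * (v + ((min n m : ℕ) : ℝ)) ^ 2) * (2 * ∑ i, (Y * Nᵀ) i i) ^ 2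
      ≤ frameHessian N Y l := by
  have hr : ∀ i, 0 ≤ ∑ α, Y i α ^ 2 - ∑ j, rowComponent N Y l i j ^ 2 := fun i =>
    sub_nonneg.2 (sum_rowComponent_sq_le hN Y i)
  have hv0 : 0 ≤ v := hsum ▸ Finset.sum_nonneg fun i _ => sq_nonneg _
  have hκ : 0 ≤ 2 - v ^ 2 / 2 := by nlinarith
  have hdu := diagonal_estimate l (fun i => rowComponent N Y l i i) hsum hv
    (p := ((min n m : ℕ) : ℝ)) (by exact_mod_cast card_ne_zero_le hN)
    (by exact_mod_cast le_min hn hm)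
  have hF := sum_diag_le_sum_sum (fun i j => 2 * rowComponent N Y l i j ^ 2
      + 4 * (l i * l j * rowComponent N Y l i j * rowComponent N Y l j i) / (1 + l j ^ 2)
      - (2 - v ^ 2 / 2) * (rowComponent N Y l i j ^ 2 / ((1 + l i ^ 2) * (1 + l j ^ 2))))
    fun i j hij => pair_estimate _ _ _ _ _ (by
      rw [← hsum, ← Finset.sum_pair (f := fun i => l i ^ 2) hij]
      exact Finset.sum_le_univ_sum_of_nonneg fun i => sq_nonneg _) (hl i) (hl j)
  rw [frameHessian_eq hN]
  simp only [← mul_rowComponent hN]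
  set c := rowComponent N Y l with hc
  set r := fun i => ∑ α, Y i α ^ 2 - ∑ j, c i j ^ 2 with hrdef
  have hY : ∀ i, ∑ α, Y i α ^ 2 = r i + ∑ j, c i j ^ 2 := fun i => by simp [hrdef]
  have hg : ∑ i, (∑ α, Y i α ^ 2 - ∑ j, (l j * c i j) ^ 2 / (1 + l j ^ 2)) / (1 + l i ^ 2) =
      ∑ i, r i / (1 + l i ^ 2) + ∑ i, ∑ j, c i j ^ 2 / ((1 + l i ^ 2) * (1 + l j ^ 2)) := by
    rw [← Finset.sum_add_distrib]
    refine Finset.sum_congr rfl fun i _ => ?_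
    rw [hY, add_sub_assoc, add_div, ← Finset.sum_sub_distrib, Finset.sum_div]
    congr 1
    refine Finset.sum_congr rfl fun j _ => ?_
    field_simp
    ring
  have hrr : (2 - v ^ 2 / 2) * ∑ i, r i / (1 + l i ^ 2) ≤ 2 * ∑ i, r i := by
    have h1 : ∑ i, r i / (1 + l i ^ 2) ≤ ∑ i, r i :=
      Finset.sum_le_sum fun i _ => div_le_self (hr i) (by nlinarith [sq_nonneg (l i)])
    have h2 : 0 ≤ ∑ i, r i := Finset.sum_nonneg fun i _ => hr i
    calc _ ≤ (2 - v ^ 2 / 2) * ∑ i, r i := mul_le_mul_of_nonneg_left h1 hκ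
      _ ≤ 2 * ∑ i, r i := mul_le_mul_of_nonneg_right (by nlinarith [sq_nonneg v]) h2
  -- With t = l i ^ 2, 2(1 + t)² + 4t(1 + t) - (2 - v²/2) = 6t² + 8t + v²/2: the source of the
  -- weights in `diagonal_estimate`.
  have hd : ∑ i, (6 * (l i ^ 2) ^ 2 + 8 * l i ^ 2 + v ^ 2 / 2) / (1 + l i ^ 2) ^ 2 * c i i ^ 2 =
      ∑ i, (2 * c i i ^ 2 + 4 * (l i * l i * c i i * c i i) / (1 + l i ^ 2)
        - (2 - v ^ 2 / 2) * (c i i ^ 2 / ((1 + l i ^ 2) * (1 + l i ^ 2)))) :=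
    Finset.sum_congr rfl fun i _ => by
      field_simp
      ring
  have hF' : ∑ i, ∑ j, (2 * c i j ^ 2 + 4 * (l i * l j * c i j * c j i) / (1 + l j ^ 2)
      - (2 - v ^ 2 / 2) * (c i j ^ 2 / ((1 + l i ^ 2) * (1 + l j ^ 2)))) =
      ∑ i, ∑ j, (2 * c i j ^ 2 + 4 * (l i * l j * c i j * c j i) / (1 + l j ^ 2))
      - (2 - v ^ 2 / 2) * ∑ i, ∑ j, c i j ^ 2 / ((1 + l i ^ 2) * (1 + l j ^ 2)) := by
    simp only [Finset.sum_sub_distrib, Finset.mul_sum]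
  rw [hg, mul_add]
  rw [hd] at hdu
  rw [hF'] at hF
  change _ ≤ 2 * ∑ i, r i + _
  linarith

end DiagonalFrame

/-! ### Jordan angles and the singular values of `Z` -/

theorem isUnit_det_one_add {k l : ℕ} (Z : Matrix (Fin k) (Fin l) ℝ) :
    IsUnit (1 + Z * Zᵀ).det := by
  have hK : (1 + Z * Zᵀ).PosDef :=
    Matrix.PosDef.one.add_posSemidef (Matrix.posSemidef_self_mul_conjTranspose Z)
  exact hK.det_pos.ne'.isUnit

theorem isUnit_det_one_add' {k l : ℕ} (Z : Matrix (Fin k) (Fin l) ℝ) :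
    IsUnit (1 + Zᵀ * Z).det := by
  simpa using isUnit_det_one_add Zᵀ

/-- The matrix form of cos² θ (1 + tan² θ) = 1, obtained from orthonormality of the frame. -/
theorem cosSq_mul_one_add (ε : RefBasis n m) (P : U ε) :
    cosSq ε P.1 * (1 + chart ε P * (chart ε P)ᵀ) = 1 := by
  obtain ⟨P, hP⟩ := P
  induction P using Quotient.inductionOn with
  | h e =>
  change 0 < (matW ε e).det at hP
  change (matW ε e)ᵀ * matW ε e *
    (1 + ((matW ε e)⁻¹ * matV ε e) * ((matW ε e)⁻¹ * matV ε e)ᵀ) = 1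
  have hu : IsUnit (matW ε e).det := hP.ne'.isUnit
  rw [Matrix.mul_assoc]
  exact mul_eq_one_comm.1 (matW_gram ε e hP)

/-- An orthogonal matrix diagonalizing `Z Zᵀ`, with the numbers `tan² θ_i` as eigenvalues. -/
theorem exists_orthogonal_diagonal (ε : RefBasis n m) (P : U ε) :
    ∃ V : Matrix (Fin n) (Fin n) ℝ, Vᵀ * V = 1 ∧ V * Vᵀ = 1 ∧
      chart ε P * (chart ε P)ᵀ =
        V * (Matrix.diagonal fun i => Real.tan (jordanAngle ε P.1 i) ^ 2) * Vᵀ ∧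
      ∀ i, jordanAngle ε P.1 i < Real.pi / 2 := by
  have hC := cosSq_mul_one_add ε P
  set Z := chart ε P with hZ
  have hH := cosSq_isHermitian ε P.1
  set V : Matrix (Fin n) (Fin n) ℝ := hH.eigenvectorUnitary.1 with hV
  have hV1 : Vᵀ * V = 1 := (Matrix.mem_unitaryGroup_iff').1 hH.eigenvectorUnitary.2
  have hV2 : V * Vᵀ = 1 := (Matrix.mem_unitaryGroup_iff).1 hH.eigenvectorUnitary.2
  have hs : cosSq ε P.1 = V * Matrix.diagonal hH.eigenvalues * Vᵀ := by
    have := hH.spectral_theorem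
    rw [Unitary.conjStarAlgAut_apply] at this
    exact this
  have hD : Matrix.diagonal hH.eigenvalues * (Vᵀ * (1 + Z * Zᵀ) * V) = 1 := by
    rw [hs] at hC
    calc _ = Vᵀ * (V * Matrix.diagonal hH.eigenvalues * Vᵀ * (1 + Z * Zᵀ)) * V := by
          simp only [← Matrix.mul_assoc, hV1, Matrix.one_mul]
      _ = 1 := by rw [hC, Matrix.mul_one, hV1]
  have hD' : Vᵀ * (1 + Z * Zᵀ) * V = 1 + (Vᵀ * Z) * (Vᵀ * Z)ᵀ := by
    rw [Matrix.mul_add, Matrix.add_mul, Matrix.mul_one, hV1, Matrix.transpose_mul,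
      Matrix.transpose_transpose]
    simp only [Matrix.mul_assoc]
  rw [hD'] at hD
  -- Entrywise, μ_i² (δ_ij + M_ij) = δ_ij for M = Vᵀ Z Zᵀ V: this gives μ_i² > 0, M_ii = 1/μ_i² - 1
  -- = tan² θ_i, and M diagonal.
  have hent : ∀ i j, hH.eigenvalues i * ((1 : Matrix (Fin n) (Fin n) ℝ) i j +
      ((Vᵀ * Z) * (Vᵀ * Z)ᵀ) i j) = (1 : Matrix (Fin n) (Fin n) ℝ) i j := fun i j => by
    have := congrFun (congrFun hD i) j
    rwa [Matrix.diagonal_mul, Matrix.add_apply] at this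
  have hnn : ∀ i, 0 ≤ ((Vᵀ * Z) * (Vᵀ * Z)ᵀ) i i := fun i => by
    rw [Matrix.mul_apply]
    exact Finset.sum_nonneg fun α _ => mul_self_nonneg _
  have hpos : ∀ i, 0 < hH.eigenvalues i := fun i => by
    have h1 := hent i i
    rw [Matrix.one_apply_eq] at h1
    have h2 := hnn i
    by_contra! h
    nlinarith
  have htan : ∀ i, ((Vᵀ * Z) * (Vᵀ * Z)ᵀ) i i = Real.tan (jordanAngle ε P.1 i) ^ 2 := fun i => by
    have h1 := hent i i
    rw [Matrix.one_apply_eq] at h1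
    have h2 := hnn i
    have h3 := hpos i
    have h4 : 0 ≤ 1 - hH.eigenvalues i := by nlinarith
    rw [jordanAngle, Real.tan_arccos, div_pow, Real.sq_sqrt h3.le, Real.sq_sqrt h4,
      eq_div_iff h3.ne']
    linarith
  have hdiag : (Vᵀ * Z) * (Vᵀ * Z)ᵀ =
      Matrix.diagonal fun i => Real.tan (jordanAngle ε P.1 i) ^ 2 := by
    ext i j
    rcases eq_or_ne i j with rfl | hij
    · rw [htan, Matrix.diagonal_apply_eq]
    · have := hent i j
      rw [Matrix.one_apply_ne hij, zero_add, mul_eq_zero] at this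
      rw [this.resolve_left (hpos i).ne', Matrix.diagonal_apply_ne _ hij]
  refine ⟨V, hV1, hV2, ?_, fun i => Real.arccos_lt_pi_div_two.2 (Real.sqrt_pos.2 (hpos i))⟩
  rw [← hdiag, Matrix.transpose_mul, Matrix.transpose_transpose]
  calc Z * Zᵀ = (V * Vᵀ) * (Z * Zᵀ) * (V * Vᵀ) := by rw [hV2, Matrix.one_mul, Matrix.mul_one]
    _ = _ := by simp only [Matrix.mul_assoc]

theorem u_eq_trace (ε : RefBasis n m) (P : U ε) :
    u ε P = (chart ε P * (chart ε P)ᵀ).trace := by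
  obtain ⟨V, hV1, -, hZ, -⟩ := exists_orthogonal_diagonal ε P
  rw [hZ, Matrix.trace_mul_comm, ← Matrix.mul_assoc, hV1, Matrix.one_mul, Matrix.trace_diagonal]
  rfl

theorem tan_jordanAngle_nonneg (ε : RefBasis n m) (P : U ε) (i : Fin n) :
    0 ≤ Real.tan (jordanAngle ε P.1 i) := by
  obtain ⟨-, -, -, -, h⟩ := exists_orthogonal_diagonal ε P
  exact Real.tan_nonneg_of_nonneg_of_le_pi_div_two (Real.arccos_nonneg _) (h i).le

theorem tan_mul_tan_lt_one {a b : ℝ} (ha : 0 ≤ a) (hb : 0 ≤ b) (hab : a + b < Real.pi / 2) :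
    Real.tan a * Real.tan b < 1 := by
  have hca : 0 < Real.cos a := Real.cos_pos_of_mem_Ioo ⟨by linarith [Real.pi_pos], by linarith⟩
  have hcb : 0 < Real.cos b := Real.cos_pos_of_mem_Ioo ⟨by linarith [Real.pi_pos], by linarith⟩
  have hc : 0 < Real.cos (a + b) :=
    Real.cos_pos_of_mem_Ioo ⟨by linarith [Real.pi_pos], hab⟩
  rw [Real.cos_add] at hc
  rw [Real.tan_eq_sin_div_cos, Real.tan_eq_sin_div_cos, div_mul_div_comm, div_lt_one (by positivity)]
  linarith

/-! ### Passing to a diagonal frame -/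

section Reduction

variable {Z : Matrix (Fin n) (Fin m) ℝ} {V : Matrix (Fin n) (Fin n) ℝ} {l : Fin n → ℝ}

theorem frame_mul_transpose (hV : Vᵀ * V = 1)
    (hZ : Z * Zᵀ = V * (Matrix.diagonal fun i => l i ^ 2) * Vᵀ) :
    (Vᵀ * Z) * (Vᵀ * Z)ᵀ = Matrix.diagonal fun i => l i ^ 2 := by
  calc _ = Vᵀ * (Z * Zᵀ) * V := by
        rw [Matrix.transpose_mul, Matrix.transpose_transpose]
        simp only [Matrix.mul_assoc]
    _ = (Vᵀ * V) * (Matrix.diagonal fun i => l i ^ 2) * (Vᵀ * V) := by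
        rw [hZ]
        simp only [Matrix.mul_assoc]
    _ = _ := by rw [hV, Matrix.one_mul, Matrix.mul_one]

theorem inv_one_add_eq (hV : Vᵀ * V = 1) (hV' : V * Vᵀ = 1)
    (hZ : Z * Zᵀ = V * (Matrix.diagonal fun i => l i ^ 2) * Vᵀ) :
    (1 + Z * Zᵀ)⁻¹ = V * (Matrix.diagonal fun i => (1 + l i ^ 2)⁻¹) * Vᵀ := by
  refine Matrix.inv_eq_left_inv ?_
  have h1 : 1 + Z * Zᵀ = V * (Matrix.diagonal fun i => 1 + l i ^ 2) * Vᵀ := by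
    rw [hZ, ← Matrix.diagonal_add, Matrix.mul_add, Matrix.add_mul,
      Matrix.diagonal_one, Matrix.mul_one, hV']
  rw [h1]
  calc _ = V * (Matrix.diagonal fun i => (1 + l i ^ 2)⁻¹) * (Vᵀ * V) *
        (Matrix.diagonal fun i => 1 + l i ^ 2) * Vᵀ := by simp only [Matrix.mul_assoc]
    _ = V * ((Matrix.diagonal fun i => (1 + l i ^ 2)⁻¹) *
        (Matrix.diagonal fun i => 1 + l i ^ 2)) * Vᵀ := by
        rw [hV, Matrix.mul_one]
        simp only [Matrix.mul_assoc]
    _ = 1 := by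
        rw [Matrix.diagonal_mul_diagonal]
        have : (fun i => (1 + l i ^ 2)⁻¹ * (1 + l i ^ 2)) = fun _ => (1 : ℝ) :=
          funext fun i => inv_mul_cancel₀ (by positivity)
        rw [this, Matrix.diagonal_one, Matrix.mul_one, hV']

theorem trace_conj (hV' : V * Vᵀ = 1) (S : Matrix (Fin n) (Fin n) ℝ) :
    (Vᵀ * S * V).trace = S.trace := by
  rw [Matrix.trace_mul_comm, ← Matrix.mul_assoc, hV', Matrix.one_mul]

theorem frame_product (X : Matrix (Fin n) (Fin m) ℝ) :
    (Vᵀ * X) * (Vᵀ * Z)ᵀ = Vᵀ * (X * Zᵀ) * V := by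
  rw [Matrix.transpose_mul, Matrix.transpose_transpose]
  simp only [Matrix.mul_assoc]

theorem trace_mul_transpose_eq (X : Matrix (Fin n) (Fin m) ℝ) :
    (X * Xᵀ).trace = ∑ i, ∑ α, X i α ^ 2 := by
  simp [Matrix.trace, Matrix.mul_apply, pow_two]

theorem frameHessian_frame (hV : Vᵀ * V = 1) (hV' : V * Vᵀ = 1)
    (hZ : Z * Zᵀ = V * (Matrix.diagonal fun i => l i ^ 2) * Vᵀ) (X : Matrix (Fin n) (Fin m) ℝ) :
    frameHessian (Vᵀ * Z) (Vᵀ * X) l =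
      2 * (X * Xᵀ).trace + 4 * ((X * Zᵀ) * (1 + Z * Zᵀ)⁻¹ * (X * Zᵀ)).trace := by
  rw [frameHessian, ← trace_mul_transpose_eq, frame_product, trace_conj hV',
    inv_one_add_eq hV hV' hZ, ← trace_conj hV' (X * Zᵀ * _ * _), frame_product]
  have : Vᵀ * (X * Zᵀ * (V * (Matrix.diagonal fun i => (1 + l i ^ 2)⁻¹) * Vᵀ) * (X * Zᵀ)) * V =
      (Vᵀ * (X * Zᵀ) * V) * (Matrix.diagonal fun i => (1 + l i ^ 2)⁻¹) * (Vᵀ * (X * Zᵀ) * V) := by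
    simp only [Matrix.mul_assoc]
  rw [this]
  generalize Vᵀ * (X * Zᵀ) * V = M
  congr 2
  simp only [Matrix.trace, Matrix.diag_apply]
  refine Finset.sum_congr rfl fun i _ => ?_
  rw [Matrix.mul_apply]
  refine Finset.sum_congr rfl fun j _ => ?_
  rw [Matrix.mul_diagonal]
  ring

theorem inv_mul_eq_mul_inv (Z : Matrix (Fin n) (Fin m) ℝ) :
    (1 + Z * Zᵀ)⁻¹ * Z = Z * (1 + Zᵀ * Z)⁻¹ := by
  have h1 := isUnit_det_one_add Z
  have h2 := isUnit_det_one_add' Z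
  calc _ = (1 + Z * Zᵀ)⁻¹ * (Z * (1 + Zᵀ * Z)) * (1 + Zᵀ * Z)⁻¹ := by
        rw [Matrix.mul_assoc, Matrix.mul_nonsing_inv_cancel_right _ _ h2]
    _ = (1 + Z * Zᵀ)⁻¹ * ((1 + Z * Zᵀ) * Z) * (1 + Zᵀ * Z)⁻¹ := by
        rw [Matrix.mul_add, Matrix.add_mul, Matrix.one_mul, Matrix.mul_one, Matrix.mul_assoc Z]
    _ = _ := by rw [Matrix.nonsing_inv_mul_cancel_left _ _ h1]

theorem inv_one_add_transpose_mul (Z : Matrix (Fin n) (Fin m) ℝ) :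
    (1 + Zᵀ * Z)⁻¹ = 1 - Zᵀ * (1 + Z * Zᵀ)⁻¹ * Z := by
  rw [Matrix.mul_assoc, inv_mul_eq_mul_inv, ← Matrix.mul_assoc, eq_sub_iff_add_eq]
  have := Matrix.mul_nonsing_inv _ (isUnit_det_one_add' Z)
  rwa [Matrix.add_mul, Matrix.one_mul] at this

/-- Writing (1 + Zᵀ Z)⁻¹ = 1 - Zᵀ (1 + Z Zᵀ)⁻¹ Z leaves only n × n inverses, all diagonal in the
rotated frame. -/
theorem metric_frame (hV : Vᵀ * V = 1) (hV' : V * Vᵀ = 1)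
    (hZ : Z * Zᵀ = V * (Matrix.diagonal fun i => l i ^ 2) * Vᵀ) (X : Matrix (Fin n) (Fin m) ℝ) :
    metric Z X X = ∑ i, (∑ α, (Vᵀ * X) i α ^ 2
        - ∑ j, ((Vᵀ * X) * (Vᵀ * Z)ᵀ) i j ^ 2 / (1 + l j ^ 2)) / (1 + l i ^ 2) := by
  set D := Matrix.diagonal fun i => (1 + l i ^ 2)⁻¹ with hD
  set M := (Vᵀ * X) * (Vᵀ * Z)ᵀ with hM
  have h1 : metric Z X X = (D * ((Vᵀ * X) * (Vᵀ * X)ᵀ - M * D * Mᵀ)).trace := by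
    rw [metric, inv_one_add_transpose_mul, inv_one_add_eq hV hV' hZ, ← hD]
    calc _ = (V * (D * (Vᵀ * (X * (1 - Zᵀ * (V * D * Vᵀ) * Z) * Xᵀ)))).trace := by
          simp only [Matrix.mul_assoc]
      _ = (D * (Vᵀ * (X * (1 - Zᵀ * (V * D * Vᵀ) * Z) * Xᵀ) * V)).trace := by
          rw [Matrix.trace_mul_comm]
          simp only [Matrix.mul_assoc]
      _ = _ := by
          congr 2
          rw [hM]
          simp only [Matrix.transpose_mul, Matrix.transpose_transpose, Matrix.mul_sub,
            Matrix.sub_mul, Matrix.mul_one, Matrix.mul_assoc]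
  rw [h1, Matrix.trace]
  refine Finset.sum_congr rfl fun i _ => ?_
  rw [Matrix.diag_apply, hD, Matrix.diagonal_mul, ← hD, Matrix.sub_apply, inv_mul_eq_div]
  congr 2
  · rw [Matrix.mul_apply]
    exact Finset.sum_congr rfl fun α _ => (pow_two _).symm
  · rw [Matrix.mul_apply]
    refine Finset.sum_congr rfl fun j _ => ?_
    rw [hD, Matrix.mul_diagonal, Matrix.transpose_apply]
    ring

end Reduction

/-! ### The Levi-Civita connection of the canonical metric -/

section Derivative

open scoped Matrix.Norms.Operator

theorem hasDerivAt_matrix_inv {k : ℕ} {K : ℝ → Matrix (Fin k) (Fin k) ℝ}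
    {K' : Matrix (Fin k) (Fin k) ℝ} {t : ℝ} (hK : HasDerivAt K K' t) (hu : IsUnit (K t).det) :
    HasDerivAt (fun s => (K s)⁻¹) (-((K t)⁻¹ * K' * (K t)⁻¹)) t := by
  obtain ⟨x, hx⟩ := (Matrix.isUnit_iff_isUnit_det _).2 hu
  have h := hasFDerivAt_ringInverse (𝕜 := ℝ) x
  rw [hx] at h
  have hx' : (↑x⁻¹ : Matrix (Fin k) (Fin k) ℝ) = (K t)⁻¹ := by
    rw [← hx, Matrix.coe_units_inv]
  have := h.comp_hasDerivAt t hK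
  rw [hx'] at this
  simp only [Function.comp_def, neg_apply, ContinuousLinearMap.mulLeftRight_apply] at this
  simp only [Matrix.nonsing_inv_eq_ringInverse] at this ⊢
  exact this

/-- Stated entrywise, so that the operator norm used to differentiate the inverse does not enter the
conclusion. -/
theorem hasDerivAt_inv_one_add_apply {k l : ℕ} (Z D : Matrix (Fin k) (Fin l) ℝ) (i j : Fin k) :
    HasDerivAt (fun t : ℝ => ((1 + (Z + t • D) * (Z + t • D)ᵀ)⁻¹ : Matrix (Fin k) (Fin k) ℝ) i j)
      ((-((1 + Z * Zᵀ)⁻¹ * (D * Zᵀ + Z * Dᵀ) * (1 + Z * Zᵀ)⁻¹) :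
        Matrix (Fin k) (Fin k) ℝ) i j) 0 := by
  have hK : HasDerivAt (fun t : ℝ => 1 + (Z + t • D) * (Z + t • D)ᵀ) (D * Zᵀ + Z * Dᵀ) 0 := by
    have hexp : (fun t : ℝ => 1 + (Z + t • D) * (Z + t • D)ᵀ) = fun t : ℝ =>
        (1 + Z * Zᵀ) + (t • (D * Zᵀ + Z * Dᵀ) + (t ^ 2) • (D * Dᵀ)) := by
      funext t
      simp only [Matrix.transpose_add, Matrix.transpose_smul, Matrix.add_mul, Matrix.mul_add,
        Matrix.smul_mul, Matrix.mul_smul, smul_add, smul_smul, pow_two]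
      abel
    rw [hexp]
    have h1 := (hasDerivAt_id (0 : ℝ)).smul_const (D * Zᵀ + Z * Dᵀ)
    have h2 := (hasDerivAt_pow 2 (0 : ℝ)).smul_const (D * Dᵀ)
    have h3 := (h1.add h2).const_add (1 + Z * Zᵀ)
    refine h3.congr_deriv ?_
    simp only [one_smul, Nat.cast_ofNat, Nat.add_one_sub_one, pow_one, mul_zero, zero_smul,
      add_zero]
  have h := hasDerivAt_matrix_inv hK (by simpa using isUnit_det_one_add Z)
  simp only [zero_smul, add_zero] at h
  exact hasDerivAt_pi.1 (hasDerivAt_pi.1 h i) j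

end Derivative

/-- The derivative of `metric Z X Y` in the direction `D` of the base point. -/
def metricDeriv (Z D X Y : Matrix (Fin n) (Fin m) ℝ) : ℝ :=
  -(((1 + Z * Zᵀ)⁻¹ * (D * Zᵀ + Z * Dᵀ) * (1 + Z * Zᵀ)⁻¹ * X * (1 + Zᵀ * Z)⁻¹ * Yᵀ).trace
    + ((1 + Z * Zᵀ)⁻¹ * X * ((1 + Zᵀ * Z)⁻¹ * (Dᵀ * Z + Zᵀ * D) * (1 + Zᵀ * Z)⁻¹) * Yᵀ).trace)

theorem trace_mul_E (A : Matrix (Fin n) (Fin n) ℝ) (B : Matrix (Fin m) (Fin m) ℝ)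
    (a b : Fin n × Fin m) : (A * E a * B * (E b)ᵀ).trace = A b.1 a.1 * B a.2 b.2 := by
  simp [E, Matrix.trace, Matrix.mul_apply, Matrix.single_apply, ite_and]

theorem metricMatrix_apply (Z : Matrix (Fin n) (Fin m) ℝ) (a b : Fin n × Fin m) :
    metricMatrix Z a b = ((1 + Z * Zᵀ)⁻¹ : Matrix (Fin n) (Fin n) ℝ) b.1 a.1 *
      ((1 + Zᵀ * Z)⁻¹ : Matrix (Fin m) (Fin m) ℝ) a.2 b.2 :=
  trace_mul_E _ _ a b

theorem pd_metricMatrix (Z : Matrix (Fin n) (Fin m) ℝ) (a b d : Fin n × Fin m) :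
    pd d (fun Y => metricMatrix Y a b) Z = metricDeriv Z (E d) (E a) (E b) := by
  have h1 := hasDerivAt_inv_one_add_apply Z (E d) b.1 a.1
  -- The factor (1 + Zᵀ Z)⁻¹ is covered by the same lemma at Zᵀ.
  have h2 := hasDerivAt_inv_one_add_apply Zᵀ (E d)ᵀ a.2 b.2
  have h := h1.mul h2
  have hd : HasDerivAt (fun t : ℝ => metricMatrix (Z + t • E d) a b)
      (metricDeriv Z (E d) (E a) (E b)) 0 := by
    have hf : (fun t : ℝ => metricMatrix (Z + t • E d) a b) = (fun t : ℝ =>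
        ((1 + (Z + t • E d) * (Z + t • E d)ᵀ)⁻¹ : Matrix (Fin n) (Fin n) ℝ) b.1 a.1) *
        fun t : ℝ => ((1 + (Zᵀ + t • (E d)ᵀ) * (Zᵀ + t • (E d)ᵀ)ᵀ)⁻¹ :
          Matrix (Fin m) (Fin m) ℝ) a.2 b.2 := by
      funext t
      simp [metricMatrix_apply]
    rw [hf]
    refine h.congr_deriv ?_
    unfold metricDeriv
    rw [trace_mul_E _ _ a b, trace_mul_E _ _ a b]
    simp only [Matrix.transpose_transpose, zero_smul, add_zero, Matrix.neg_apply]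
    ring
  exact hd.deriv

/-- The metric is a Kronecker product of two invertible matrices. -/
theorem isUnit_det_metricMatrix (Z : Matrix (Fin n) (Fin m) ℝ) :
    IsUnit (metricMatrix Z).det := by
  have h : metricMatrix Z = Matrix.kroneckerMap (· * ·) ((1 + Z * Zᵀ)⁻¹)ᵀ (1 + Zᵀ * Z)⁻¹ := by
    ext a b
    rw [metricMatrix_apply]
    rfl
  rw [h, Matrix.det_kronecker, Matrix.det_transpose]
  exact ((Matrix.isUnit_nonsing_inv_det _ (isUnit_det_one_add Z)).pow _).mul
    ((Matrix.isUnit_nonsing_inv_det _ (isUnit_det_one_add' Z)).pow _)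

theorem sum_smul_E (X : Matrix (Fin n) (Fin m) ℝ) : ∑ a, X a.1 a.2 • E a = X := by
  rw [Fintype.sum_prod_type]
  conv_rhs => rw [Matrix.matrix_eq_sum_single X]
  simp [E, Matrix.smul_single]

theorem sum_mul_apply_E {f : Matrix (Fin n) (Fin m) ℝ → ℝ} (hf : IsLinearMap ℝ f)
    (X : Matrix (Fin n) (Fin m) ℝ) : ∑ a, X a.1 a.2 * f (E a) = f X := by
  have h := congrArg (hf.mk' f) (sum_smul_E X)
  simpa [map_sum] using h

theorem isLinearMap_metric (Z X : Matrix (Fin n) (Fin m) ℝ) : IsLinearMap ℝ (metric Z X) where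
  map_add Y Y' := by simp [metric, Matrix.mul_add]
  map_smul c Y := by simp [metric]

theorem isLinearMap_metricDeriv₁ (Z X Y : Matrix (Fin n) (Fin m) ℝ) :
    IsLinearMap ℝ fun D => metricDeriv Z D X Y where
  map_add D D' := by
    simp only [metricDeriv, Matrix.transpose_add, Matrix.mul_add, Matrix.add_mul, Matrix.trace_add]
    ring
  map_smul c D := by
    simp only [metricDeriv, Matrix.transpose_smul, Matrix.mul_smul, Matrix.smul_mul, ← smul_add,
      Matrix.trace_smul, smul_neg]

theorem isLinearMap_metricDeriv₂ (Z D Y : Matrix (Fin n) (Fin m) ℝ) :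
    IsLinearMap ℝ fun X => metricDeriv Z D X Y where
  map_add X X' := by
    simp only [metricDeriv, Matrix.mul_add, Matrix.add_mul, Matrix.trace_add]
    ring
  map_smul c X := by
    simp only [metricDeriv, Matrix.mul_smul, Matrix.smul_mul, ← smul_add,
      Matrix.trace_smul, smul_neg]

theorem isLinearMap_metricDeriv₃ (Z D X : Matrix (Fin n) (Fin m) ℝ) :
    IsLinearMap ℝ (metricDeriv Z D X) where
  map_add Y Y' := by
    simp only [metricDeriv, Matrix.transpose_add, Matrix.mul_add, Matrix.trace_add]
    ring
  map_smul c Y := by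
    simp only [metricDeriv, Matrix.transpose_smul, Matrix.mul_smul, ← smul_add,
      Matrix.trace_smul, smul_neg]

/-- Koszul's formula with both arguments equal to X. Each term is brought to the form tr(Dᵀ S) by
cyclicity and transposition, and the push-through relation A Z = Z B normalizes S; the terms then
match or cancel. -/
theorem metricDeriv_koszul (Z D X : Matrix (Fin n) (Fin m) ℝ) :
    -metricDeriv Z D X X + metricDeriv Z X X D + metricDeriv Z X D X =
      2 * metric Z D (-(2 : ℝ) • (X * Zᵀ * (1 + Z * Zᵀ)⁻¹ * X)) := by
  have hA : ((1 + Z * Zᵀ)⁻¹)ᵀ = (1 + Z * Zᵀ)⁻¹ := by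
    rw [Matrix.transpose_nonsing_inv]
    simp
  have hB : ((1 + Zᵀ * Z)⁻¹)ᵀ = (1 + Zᵀ * Z)⁻¹ := by
    rw [Matrix.transpose_nonsing_inv]
    simp
  have hAZ := inv_mul_eq_mul_inv Z
  unfold metricDeriv metric
  generalize (1 + Z * Zᵀ)⁻¹ = A at *
  generalize (1 + Zᵀ * Z)⁻¹ = B at *
  have hZA : Zᵀ * A = B * Zᵀ := by
    have := congrArg Matrix.transpose hAZ
    rwa [Matrix.transpose_mul, Matrix.transpose_mul, hA, hB] at this
  have hAZ' : ∀ {k : ℕ} (S : Matrix (Fin m) (Fin k) ℝ), A * (Z * S) = Z * (B * S) := fun S => by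
    rw [← Matrix.mul_assoc, hAZ, Matrix.mul_assoc]
  have hZA' : ∀ {k : ℕ} (S : Matrix (Fin n) (Fin k) ℝ), Zᵀ * (A * S) = B * (Zᵀ * S) := fun S => by
    rw [← Matrix.mul_assoc, hZA, Matrix.mul_assoc]
  have cyc : ∀ {k : ℕ} (P : Matrix (Fin k) (Fin m) ℝ) (Q : Matrix (Fin n) (Fin k) ℝ),
      (P * (Dᵀ * Q)).trace = (Dᵀ * (Q * P)).trace := fun P Q => by
    rw [Matrix.trace_mul_comm, Matrix.mul_assoc]
  have cyc' : ∀ {k : ℕ} (P : Matrix (Fin k) (Fin n) ℝ) (Q : Matrix (Fin m) (Fin k) ℝ),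
      (P * (D * Q)).trace = (Dᵀ * (Pᵀ * Qᵀ)).trace := fun P Q => by
    rw [← Matrix.trace_transpose, Matrix.transpose_mul, Matrix.transpose_mul, Matrix.mul_assoc,
      Matrix.trace_mul_comm, Matrix.mul_assoc]
  have e1 := cyc' A (Zᵀ * (A * (X * (B * Xᵀ))))
  have e2 := cyc (A * Z) (A * (X * (B * Xᵀ)))
  have e3 := cyc (A * (X * B)) (Z * (B * Xᵀ))
  have e4 := cyc' (A * (X * (B * Zᵀ))) (B * Xᵀ)
  have f1 := cyc (A * (X * (Zᵀ * (A * (X * B))))) (1 : Matrix (Fin n) (Fin n) ℝ)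
  have f2 := cyc (A * (Z * (Xᵀ * (A * (X * B))))) (1 : Matrix (Fin n) (Fin n) ℝ)
  have f3 := cyc (A * (X * (B * (Xᵀ * (Z * B))))) (1 : Matrix (Fin n) (Fin n) ℝ)
  have g2 := cyc' (A * (Z * (Xᵀ * A))) (B * Xᵀ)
  have g3 := cyc' A (B * (Xᵀ * (Z * (B * Xᵀ))))
  simp only [Matrix.transpose_mul, Matrix.transpose_transpose, hA, hB, Matrix.mul_assoc, hAZ,
    hAZ', hZA', Matrix.mul_one, Matrix.one_mul] at e1 e2 e3 e4 f1 f2 f3 g2 g3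
  simp only [Matrix.mul_add, Matrix.add_mul, Matrix.trace_add, Matrix.transpose_smul,
    Matrix.mul_smul, Matrix.trace_smul, smul_eq_mul,
    Matrix.transpose_mul, Matrix.transpose_transpose, hB, Matrix.mul_assoc, hZA,
    hAZ', e1, e2, e3, e4, f1, f2, f3, g2, g3]
  ring

/-- The contracted Christoffel symbols: `∑ Γ^c_{ab} X_a X_b` are the components of
`-2 X Zᵀ (1 + Z Zᵀ)⁻¹ X`. -/
theorem sum_christoffel (Z X : Matrix (Fin n) (Fin m) ℝ) (c : Fin n × Fin m) :
    ∑ a : Fin n × Fin m, ∑ b : Fin n × Fin m, christoffel Z c a b * X a.1 a.2 * X b.1 b.2 =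
      -2 * (X * Zᵀ * (1 + Z * Zᵀ)⁻¹ * X : Matrix (Fin n) (Fin m) ℝ) c.1 c.2 := by
  have hD : ∀ d : Fin n × Fin m,
      ∑ a : Fin n × Fin m, ∑ b : Fin n × Fin m, X a.1 a.2 * (X b.1 b.2 *
        (-pd d (fun Y => metricMatrix Y a b) Z + pd a (fun Y => metricMatrix Y b d) Z
          + pd b (fun Y => metricMatrix Y d a) Z)) =
      2 * metric Z (E d) (-(2 : ℝ) • (X * Zᵀ * (1 + Z * Zᵀ)⁻¹ * X)) := fun d => by
    rw [← metricDeriv_koszul]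
    simp only [pd_metricMatrix, mul_add, mul_neg, Finset.sum_add_distrib, Finset.sum_neg_distrib,
      ← Finset.mul_sum]
    rw [Finset.sum_congr rfl fun a _ => congrArg (X a.1 a.2 * ·)
        (sum_mul_apply_E (isLinearMap_metricDeriv₃ Z (E d) (E a)) X),
      sum_mul_apply_E (isLinearMap_metricDeriv₂ Z (E d) X) X,
      Finset.sum_congr rfl fun a _ => congrArg (X a.1 a.2 * ·)
        (sum_mul_apply_E (isLinearMap_metricDeriv₂ Z (E a) (E d)) X),
      sum_mul_apply_E (isLinearMap_metricDeriv₁ Z X (E d)) X,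
      Finset.sum_congr rfl fun a _ => congrArg (X a.1 a.2 * ·)
        (sum_mul_apply_E (isLinearMap_metricDeriv₁ Z (E d) (E a)) X),
      sum_mul_apply_E (isLinearMap_metricDeriv₃ Z X (E d)) X]
  set G := -(2 : ℝ) • (X * Zᵀ * (1 + Z * Zᵀ)⁻¹ * X) with hG
  -- The lowered index appears as multiplication by `metricMatrix Z`, which its inverse then
  -- cancels.
  have hlow : ∀ d, metric Z (E d) G = (metricMatrix Z *ᵥ fun e => G e.1 e.2) d := fun d => by
    rw [← sum_mul_apply_E (isLinearMap_metric Z (E d)) G]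
    exact Finset.sum_congr rfl fun e _ => mul_comm _ _
  calc _ = 1 / 2 * ∑ d, (metricMatrix Z)⁻¹ c d *
        ∑ a : Fin n × Fin m, ∑ b : Fin n × Fin m, X a.1 a.2 * (X b.1 b.2 *
        (-pd d (fun Y => metricMatrix Y a b) Z + pd a (fun Y => metricMatrix Y b d) Z
          + pd b (fun Y => metricMatrix Y d a) Z)) := by
        simp only [christoffel, Finset.mul_sum, Finset.sum_mul]
        conv_rhs => rw [Finset.sum_comm]
        refine Finset.sum_congr rfl fun a _ => ?_
        conv_rhs => rw [Finset.sum_comm]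
        exact Finset.sum_congr rfl fun b _ => Finset.sum_congr rfl fun d _ => by ring
    _ = ((metricMatrix Z)⁻¹ *ᵥ (metricMatrix Z *ᵥ fun e => G e.1 e.2)) c := by
        simp only [hD, hlow, Matrix.mulVec, dotProduct, Finset.mul_sum]
        refine Finset.sum_congr rfl fun d _ => Finset.sum_congr rfl fun e _ => ?_
        ring
    _ = G c.1 c.2 := by
        rw [Matrix.mulVec_mulVec, Matrix.nonsing_inv_mul _ (isUnit_det_metricMatrix Z),
          Matrix.one_mulVec]
    _ = _ := by rw [hG, Matrix.smul_apply, smul_eq_mul]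

/-! ### The differential and the Hessian of `u` -/

theorem u_comp_chart_symm (ε : RefBasis n m) :
    u ε ∘ (chart ε).symm = fun Z => (Z * Zᵀ).trace := by
  funext Z
  rw [Function.comp_apply, u_eq_trace, Equiv.apply_symm_apply]

theorem trace_mul_transpose_E (Z : Matrix (Fin n) (Fin m) ℝ) (a : Fin n × Fin m) :
    (Z * (E a)ᵀ).trace = Z a.1 a.2 := by
  simp [E, Matrix.trace, Matrix.mul_apply, Matrix.single_apply, ite_and]

theorem pd_trace (Z : Matrix (Fin n) (Fin m) ℝ) (a : Fin n × Fin m) :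
    pd a (fun Z => (Z * Zᵀ).trace) Z = 2 * Z a.1 a.2 := by
  have hexp : (fun t : ℝ => ((Z + t • E a) * (Z + t • E a)ᵀ).trace) = fun t : ℝ =>
      (Z * Zᵀ).trace + (t * (2 * Z a.1 a.2) + t ^ 2 * (E a * (E a)ᵀ : Matrix _ _ ℝ).trace) := by
    funext t
    have h : (E a * Zᵀ : Matrix (Fin n) (Fin n) ℝ).trace = Z a.1 a.2 := by
      rw [← trace_mul_transpose_E Z a, ← Matrix.trace_transpose, Matrix.transpose_mul,
        Matrix.transpose_transpose]
    simp only [Matrix.transpose_add, Matrix.transpose_smul, Matrix.add_mul, Matrix.mul_add,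
      Matrix.smul_mul, Matrix.mul_smul, Matrix.trace_add, Matrix.trace_smul, smul_eq_mul, h,
      trace_mul_transpose_E]
    ring
  have h1 := (hasDerivAt_id (0 : ℝ)).mul_const (2 * Z a.1 a.2)
  have h2 := (hasDerivAt_pow 2 (0 : ℝ)).mul_const (E a * (E a)ᵀ : Matrix (Fin n) (Fin n) ℝ).trace
  have h3 := ((h1.add h2).const_add (Z * Zᵀ).trace).deriv
  rw [pd, lineDeriv, hexp]
  refine h3.trans ?_
  simp

theorem pd_pd_trace (Z : Matrix (Fin n) (Fin m) ℝ) (a b : Fin n × Fin m) :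
    pd a (pd b fun Z => (Z * Zᵀ).trace) Z = 2 * (E a : Matrix (Fin n) (Fin m) ℝ) b.1 b.2 := by
  have h : (pd b fun Z : Matrix (Fin n) (Fin m) ℝ => (Z * Zᵀ).trace) = fun Z => 2 * Z b.1 b.2 :=
    funext fun Z => pd_trace Z b
  rw [h, pd, lineDeriv]
  have h1 := (((hasDerivAt_id (0 : ℝ)).mul_const ((E a : Matrix (Fin n) (Fin m) ℝ) b.1 b.2)).const_add
    (Z b.1 b.2)).const_mul 2
  refine h1.deriv.trans ?_
  simp

theorem sum_mul_eq_trace (X Y : Matrix (Fin n) (Fin m) ℝ) :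
    ∑ a : Fin n × Fin m, X a.1 a.2 * Y a.1 a.2 = (X * Yᵀ).trace := by
  simp [Fintype.sum_prod_type, Matrix.trace, Matrix.mul_apply]

theorem differential_u (ε : RefBasis n m) (P : U ε) (X : Matrix (Fin n) (Fin m) ℝ) :
    differential ε (u ε) P X = 2 * (X * (chart ε P)ᵀ).trace := by
  rw [← sum_mul_eq_trace, Finset.mul_sum]
  simp only [differential, u_comp_chart_symm, pd_trace]
  exact Finset.sum_congr rfl fun a _ => by ring

/-- The Christoffel symbols stay unevaluated here so that the formula can also be matched with the
geodesic equation. -/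
theorem hessian_u_eq_sub (ε : RefBasis n m) (P : U ε) (X : Matrix (Fin n) (Fin m) ℝ) :
    hessian ε (u ε) P X X = 2 * ∑ a : Fin n × Fin m, X a.1 a.2 ^ 2
      - ∑ c : Fin n × Fin m, 2 * chart ε P c.1 c.2 *
        ∑ a : Fin n × Fin m, ∑ b : Fin n × Fin m,
          christoffel (chart ε P) c a b * X a.1 a.2 * X b.1 b.2 := by
  have h1 : ∑ a : Fin n × Fin m, ∑ b : Fin n × Fin m,
      X a.1 a.2 * X b.1 b.2 * (2 * (E a : Matrix (Fin n) (Fin m) ℝ) b.1 b.2) =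
      2 * ∑ a : Fin n × Fin m, X a.1 a.2 ^ 2 := by
    rw [Finset.mul_sum]
    refine Finset.sum_congr rfl fun a _ => ?_
    rw [Finset.sum_eq_single a]
    · simp [E]
      ring
    · intro b _ hb
      rw [E, Matrix.single_apply, if_neg (fun h => hb (Prod.ext h.1.symm h.2.symm))]
      simp
    · simp
  have h2 : ∑ a : Fin n × Fin m, ∑ b : Fin n × Fin m, X a.1 a.2 * X b.1 b.2 *
      ∑ c, christoffel (chart ε P) c a b * (2 * chart ε P c.1 c.2) =
      ∑ c : Fin n × Fin m, 2 * chart ε P c.1 c.2 *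
        ∑ a : Fin n × Fin m, ∑ b : Fin n × Fin m,
          christoffel (chart ε P) c a b * X a.1 a.2 * X b.1 b.2 := by
    simp only [Finset.mul_sum]
    conv_rhs => rw [Finset.sum_comm]
    refine Finset.sum_congr rfl fun a _ => ?_
    conv_rhs => rw [Finset.sum_comm]
    exact Finset.sum_congr rfl fun b _ => Finset.sum_congr rfl fun c _ => by ring
  simp only [hessian, u_comp_chart_symm, pd_trace, pd_pd_trace, mul_sub, Finset.sum_sub_distrib,
    h1, h2]

theorem hessian_u (ε : RefBasis n m) (P : U ε) (X : Matrix (Fin n) (Fin m) ℝ) :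
    hessian ε (u ε) P X X = 2 * (X * Xᵀ).trace + 4 * ((X * (chart ε P)ᵀ) *
      (1 + chart ε P * (chart ε P)ᵀ)⁻¹ * (X * (chart ε P)ᵀ)).trace := by
  rw [hessian_u_eq_sub]
  simp only [sum_christoffel, pow_two, sum_mul_eq_trace]
  have : ∀ G : Matrix (Fin n) (Fin m) ℝ, ∑ c : Fin n × Fin m,
      2 * chart ε P c.1 c.2 * (-2 * G c.1 c.2) = -4 * (G * (chart ε P)ᵀ).trace := fun G => by
    rw [← sum_mul_eq_trace, Finset.mul_sum]
    exact Finset.sum_congr rfl fun c _ => by ring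
  rw [this]
  simp only [Matrix.mul_assoc]
  ring

/-! ### Positivity, the lower bound, and convexity along geodesics -/

theorem hessian_u_pos (ε : RefBasis n m) {P : U ε} (hP : P ∈ BJX ε)
    {X : Matrix (Fin n) (Fin m) ℝ} (hX : X ≠ 0) : 0 < hessian ε (u ε) P X X := by
  obtain ⟨V, hV, hV', hZ, -⟩ := exists_orthogonal_diagonal ε P
  rw [hessian_u, ← frameHessian_frame hV hV' hZ]
  refine frameHessian_pos (frame_mul_transpose hV hZ) (tan_jordanAngle_nonneg ε P)
    (fun i j hij => tan_mul_tan_lt_one (Real.arccos_nonneg _) (Real.arccos_nonneg _) (hP i j hij))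
    fun h => hX ?_
  rw [← Matrix.one_mul X, ← hV', Matrix.mul_assoc, h, Matrix.mul_zero]

theorem hessian_u_ge (hn : 1 ≤ n) (hm : 1 ≤ m) (ε : RefBasis n m) {P : U ε} (hP : u ε P ≤ 2)
    (X : Matrix (Fin n) (Fin m) ℝ) :
    (2 - u ε P ^ 2 / 2) * metric (chart ε P) X X
        + ((3 + ((min n m : ℕ) : ℝ) ^ 2 / 4) * u ε P + 4 * ((min n m : ℕ) : ℝ))
            / (2 * (u ε P + ((min n m : ℕ) : ℝ)) ^ 2) * differential ε (u ε) P X ^ 2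
      ≤ hessian ε (u ε) P X X := by
  obtain ⟨V, hV, hV', hZ, -⟩ := exists_orthogonal_diagonal ε P
  have h := frameHessian_ge hn hm (frame_mul_transpose hV hZ) (tan_jordanAngle_nonneg ε P) rfl hP
    (Vᵀ * X)
  rw [frameHessian_frame hV hV' hZ, ← metric_frame hV hV' hZ] at h
  rw [hessian_u, differential_u, ← trace_conj hV' (X * (chart ε P)ᵀ), ← frame_product]
  exact h

theorem geodesicallyConvexOn_u (ε : RefBasis n m) : GeodesicallyConvexOn ε (BJX ε) (u ε) := by
  rintro γ I hI hconv ⟨ξ, hξ⟩ hγ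
  have hu : ∀ t, u ε (γ t) = ∑ c : Fin n × Fin m, chart ε (γ t) c.1 c.2 ^ 2 := fun t => by
    simp only [u_eq_trace, pow_two, sum_mul_eq_trace]
  have h1 : ∀ t ∈ I, HasDerivAt (fun t => u ε (γ t))
      (∑ c : Fin n × Fin m, 2 * (chart ε (γ t) c.1 c.2 * ξ t c.1 c.2)) t := fun t ht => by
    simp only [hu]
    refine HasDerivAt.fun_sum fun c _ => ?_
    refine ((hξ t ht c).1.pow 2).congr_deriv ?_
    simp
    ring
  -- The geodesic equation replaces the acceleration by -Γ(ξ, ξ), so the second derivative of u ∘ γ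
  -- is the Hessian on the velocity.
  have h2 : ∀ t ∈ I, HasDerivAt
      (fun t => ∑ c : Fin n × Fin m, 2 * (chart ε (γ t) c.1 c.2 * ξ t c.1 c.2))
      (hessian ε (u ε) (γ t) (ξ t) (ξ t)) t := fun t ht => by
    rw [hessian_u_eq_sub, Finset.mul_sum, ← Finset.sum_sub_distrib]
    refine HasDerivAt.fun_sum fun c _ => ?_
    refine (((hξ t ht c).1.mul (hξ t ht c).2).const_mul 2).congr_deriv ?_
    ring
  refine convexOn_of_hasDerivWithinAt2_nonneg hconv
    (fun t ht => (h1 t ht).continuousAt.continuousWithinAt)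
    (fun t ht => (h1 t (interior_subset ht)).hasDerivWithinAt)
    (fun t ht => (h2 t (interior_subset ht)).hasDerivWithinAt) fun t ht => ?_
  by_cases h : ξ t = 0
  · rw [h]
    simp [hessian]
  · exact (hessian_u_pos ε (hγ t (interior_subset ht)) h).le

end OGrass

end

theorem mainTheorem5 (n m : ℕ) (hn : 1 ≤ n) (hm : 1 ≤ m) (ε : OGrass.RefBasis n m) :
    (∀ P : OGrass.U ε, OGrass.u ε P = (OGrass.chart ε P * (OGrass.chart ε P)ᵀ).trace) ∧
    OGrass.GeodesicallyConvexOn ε (OGrass.BJX ε) (OGrass.u ε) ∧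
    (∀ P ∈ OGrass.BJX ε, ∀ X : Matrix (Fin n) (Fin m) ℝ, X ≠ 0 →
      0 < OGrass.hessian ε (OGrass.u ε) P X X) ∧
    (∀ P : OGrass.U ε, OGrass.u ε P ≤ 2 → ∀ X : Matrix (Fin n) (Fin m) ℝ,
      (2 - OGrass.u ε P ^ 2 / 2) * OGrass.metric (OGrass.chart ε P) X X
        + ((3 + ((min n m : ℕ) : ℝ) ^ 2 / 4) * OGrass.u ε P + 4 * ((min n m : ℕ) : ℝ))
            / (2 * (OGrass.u ε P + ((min n m : ℕ) : ℝ)) ^ 2)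
          * OGrass.differential ε (OGrass.u ε) P X ^ 2
      ≤ OGrass.hessian ε (OGrass.u ε) P X X) :=
  ⟨OGrass.u_eq_trace ε, OGrass.geodesicallyConvexOn_u ε, fun _ hP _ hX =>
    OGrass.hessian_u_pos ε hP hX, fun _ hP X => OGrass.hessian_u_ge hn hm ε hP X⟩
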